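/- **Conditional de Finetti theorem for quasi-universal spaces.** *Conventions.* Let $\Omega=\mathbb R$, let $\mathcal B_\Omega$ be the $\sigma$-algebra of all universally measurable subsets of $\mathbb R$ (those that lie in the Lebesgue completion of the Borel $\sigma$-algebra with respect to every Borel probability measure), and let $\Omega^\Omega$ be the set of all $\mathcal B_\Omega$-$\mathcal B_\Omega$-measurable maps $\Omega\to\Omega$. * A *quasi-universal space* is a set $\mathcal X$ with a set $\mathcal X^\Omega$ of maps $\Omega\to\mathcal X$ that contains all constant maps and satisfies $\alpha\circ\varphi\in\mathcal X^\Omega$ for $\alpha\in\mathcal X^\Omega$, $\varphi\in\Omega^\Omega$. A map $f:\mathcal X\to\mathcal Y$ is *quasi-measurable* if $f\circ\alpha\in\mathcal Y^\Omega$ for all $\alpha\in\mathcal X^\Omega$. The space $\mathcal X$ carries the $\sigma$-algebra $\mathcal B_{\mathcal X}=\{A\subseteq\mathcal X : \alpha^{-1}(A)\in\mathcal B_\Omega\ \forall\alpha\in\mathcal X^\Omega\}$. Products carry the componentwise structure; in particular $\alpha\in(\mathcal X^{\mathbb N})^\Omega$ if and only if $\mathrm{pr}_n\circ\alpha\in\mathcal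 X^\Omega$ for all $n$. * $\mathcal X$ is a *universal quasi-universal space* if $\mathcal X^\Omega$ is the set of all $\mathcal B_\Omega$-$\mathcal B_{\mathcal X}$-measurable maps, and the universal completion of $(\mathcal X,\mathcal B_{\mathcal X})$ is isomorphic, as a measurable space, to some $\mathcal Z_0\in\mathcal B_\Omega$ with the $\sigma$-algebra $\{B\cap\mathcal Z_0 : B\in\mathcal B_\Omega\}$. * $\mathcal Q(\Omega)$ is the set of probability measures $\mu$ on $(\Omega,\mathcal B_\Omega)$ such that $\omega\mapsto\mu(D_\omega)$ is $\mathcal B_\Omega$-measurable for every $D\in\mathcal B_{\Omega\times\Omega}$, where $D_\omega=\{x:(\omega,x)\in D\}$; and $\mathcal Q(\Omega)^\Omega$ is the set of maps $\kappa:\Omega\to\mathcal Q(\Omega)$ such that $\omega\mapsto\kappa(\varphi(\omega))(D_\omega)$ is $\mathcal B_\Omega$-measurable for all $\varphi\in\Omega^\Omega$ and $D\in\mathcal B_{\Omega\times\Omega}$. The quasi-universal space $\mathcal P(\mathcal X)$ is the set of push-forwards $\alpha_*\mu$ (probability measures on $\mathcal B_{\mathcal X}$) with $\alpha\in\mathcal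 X^\Omega$ and $\mu\in\mathcal Q(\Omega)$, with $\mathcal P(\mathcal X)^\Omega=\{\omega\mapsto\alpha_*\kappa(\omega) : \alpha\in\mathcal X^\Omega,\ \kappa\in\mathcal Q(\Omega)^\Omega\}$. * A *Markov kernel* $K(X|Z)\in\mathcal P(\mathcal X)^{\mathcal Z}$ is a quasi-measurable map $\mathcal Z\to\mathcal P(\mathcal X)$. Composition is given by $(K(X|S)\circ P(S|Z))(X\in A\,|\,Z=z)=\int K(X\in A\,|\,S=s)\,P(S\in ds\,|\,Z=z)$. For $\mathcal X$ universal, $\bigotimes_{n\in\mathbb N}K_n(X_n|S)\in\mathcal P(\mathcal X^{\mathbb N})^{\mathcal S}$ is the kernel whose value at each $s$ is the infinite product of the probability measures $K_n(X_n|S=s)$, extended uniquely from the product $\sigma$-algebra to $\mathcal B_{\mathcal X^{\mathbb N}}$. *Theorem.* Let $\mathcal X$ be a universal quasi-universal space and $\mathcal Z$ any quasi-universal space. For a Markov kernel $Q(X_{\mathbb N}|Z)\in\mathcal P(\mathcal X^{\mathbb N})^{\mathcal Z}$ the following are equivalent: 1. $Q(X_{\mathbb N}|Z)$ is *exchangeable*,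 i.e. for every permutation $\sigma$ of $\mathbb N$ that moves only finitely many elements, and every $z\in\mathcal Z$, the measure $Q(X_{\mathbb N}|Z=z)$ is invariant under $(x_n)_n\mapsto(x_{\sigma(n)})_n$. 2. There exist a quasi-universal space $\mathcal S$ and Markov kernels $Q(X|S)\in\mathcal P(\mathcal X)^{\mathcal S}$ and $P(S|Z)\in\mathcal P(\mathcal S)^{\mathcal Z}$ such that $$Q(X_{\mathbb N}|Z)=\Big(\bigotimes_{n\in\mathbb N}Q(X_n|S)\Big)\circ P(S|Z),$$ where all $Q(X_n|S)$ are copies of $Q(X|S)$. In this case one can choose $\mathcal S=\mathcal P(\mathcal X)$ and $Q(X|S)=\mathrm{id}_{\mathcal P(\mathcal X)}$, i.e. $Q(X\in A\,|\,S=P)=P(A)$: there is a $P(S|Z)\in\mathcal P(\mathcal P(\mathcal X))^{\mathcal Z}$ for which the displayed equation holds with these choices. -/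

import Mathlib

open MeasureTheory
open scoped ENNReal

universe u v w

namespace QUS

noncomputable section

/-- The universal completion of a `σ`-algebra: the intersection of its Lebesgue completions with
respect to all probability measures. -/
@[reducible] def univCompletion {X : Type u} (m : MeasurableSpace X) : MeasurableSpace X where
  MeasurableSet' A := ∀ μ : @Measure X m, @IsProbabilityMeasure X m μ → @NullMeasurableSet X m A μ
  measurableSet_empty _ _ := MeasurableSet.empty.nullMeasurableSet
  measurableSet_compl _ hA μ hμ := (hA μ hμ).compl
  measurableSet_iUnion _ hA μ hμ := .iUnion fun n => hA n μ hμ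

lemma le_univCompletion {X : Type u} (m : MeasurableSpace X) : m ≤ univCompletion m :=
  fun _ hA _ _ => hA.nullMeasurableSet

/-- The extension of a measure to a larger `σ`-algebra consisting of null-measurable sets. -/
def extend {X : Type u} {m : MeasurableSpace X} (m' : MeasurableSpace X) (μ : @Measure X m)
    (h : ∀ A, MeasurableSet[m'] A → @NullMeasurableSet X m A μ) : @Measure X m' :=
  @OuterMeasure.toMeasure X m' (@Measure.toOuterMeasure X m μ) fun A hA t =>
    (@measure_inter_add_sdiff₀ X m μ A t (h A hA)).symm

lemma exists_null {X : Type u} {m : MeasurableSpace X} {μ : @Measure X m} {N : Set X}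
    (hN : μ N = 0) : ∃ T, N ⊆ T ∧ MeasurableSet[m] T ∧ μ T = 0 :=
  exists_measurable_superset_of_null hN

lemma prob_trim {X : Type u} {m m' : MeasurableSpace X} (hm : m ≤ m') (μ : @Measure X m')
    [h : @IsProbabilityMeasure X m' μ] : @IsProbabilityMeasure X m (μ.trim hm) := by
  refine @IsProbabilityMeasure.mk X m _ ?_
  rw [trim_measurableSet_eq hm MeasurableSet.univ]
  exact h.measure_univ

lemma extend_apply {X : Type u} {m m' : MeasurableSpace X} {μ : @Measure X m}
    (h : ∀ A, MeasurableSet[m'] A → @NullMeasurableSet X m A μ) {A : Set X}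
    (hA : MeasurableSet[m'] A) : extend m' μ h A = μ A :=
  @toMeasure_apply X m' (@Measure.toOuterMeasure X m μ) _ A hA

lemma extend_prob {X : Type u} {m m' : MeasurableSpace X} {μ : @Measure X m}
    (h : ∀ A, MeasurableSet[m'] A → @NullMeasurableSet X m A μ)
    (hμ : IsProbabilityMeasure μ) : IsProbabilityMeasure (extend m' μ h) :=
  ⟨by rw [extend_apply h .univ]; exact measure_univ⟩

/-- The universal completion is universally complete. -/
lemma univCompletion_idem {X : Type u} (m : MeasurableSpace X) :
    univCompletion (univCompletion m) = univCompletion m := by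
  refine le_antisymm (fun A hA μ hμ => ?_) (le_univCompletion _)
  have h : ∀ A, MeasurableSet[univCompletion m] A → @NullMeasurableSet X m A μ :=
    fun A hA => hA μ hμ
  have hA' := hA (extend (univCompletion m) μ h) (extend_prob h hμ)
  obtain ⟨B, hB, hAB⟩ := hA'
  have hnull : ∀ N : Set X, extend (univCompletion m) μ h N = 0 → μ N = 0 := by
    intro N hN
    obtain ⟨T, hNT, hT, hT0⟩ := exists_null hN
    rw [extend_apply h hT] at hT0
    exact measure_mono_null hNT hT0
  have hAB' : A =ᵐ[μ] B := by
    rw [ae_eq_set] at hAB ⊢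
    exact ⟨hnull _ hAB.1, hnull _ hAB.2⟩
  exact (h B hB).congr hAB'.symm

/-- Two probability measures that agree on a `σ`-algebra `m` agree on every set in the universal
completion of `m`. -/
lemma eq_of_eq_on {X : Type u} {m m' : MeasurableSpace X} (hm : m ≤ m') (hm' : m' ≤ univCompletion m)
    {μ ν : @Measure X m'} [IsProbabilityMeasure μ]
    (h : ∀ A, MeasurableSet[m] A → μ A = ν A) : μ = ν := by
  refine @Measure.ext X m' _ _ fun A hA => ?_
  have : IsProbabilityMeasure (μ.trim hm) := prob_trim hm _
  obtain ⟨B, hB, hAB⟩ := hm' A hA (μ.trim hm) inferInstance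
  have hμν : ∀ N, μ.trim hm N = 0 → μ N = 0 ∧ ν N = 0 := by
    intro N hN
    obtain ⟨T, hNT, hT, hT0⟩ := exists_null hN
    rw [trim_measurableSet_eq hm hT] at hT0
    exact ⟨measure_mono_null hNT hT0, measure_mono_null hNT (by rw [← h T hT]; exact hT0)⟩
  rw [ae_eq_set] at hAB
  have h1 : A =ᵐ[μ] B := by
    rw [ae_eq_set]; exact ⟨(hμν _ hAB.1).1, (hμν _ hAB.2).1⟩
  have h2 : A =ᵐ[ν] B := by
    rw [ae_eq_set]; exact ⟨(hμν _ hAB.1).2, (hμν _ hAB.2).2⟩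
  rw [measure_congr h1, measure_congr h2, h B hB]

/-- Measurability of a family of measures on `m` extends to the universal completion of `m`, if the
parameter space is universally complete. -/
lemma measurable_of_completion {T : Type v} {X : Type u} {t : MeasurableSpace T}
    (ht : univCompletion t = t) {m m' : MeasurableSpace X} (hm : m ≤ m')
    (κ : T → @Measure X m') (hκ : ∀ a, IsProbabilityMeasure (κ a))
    (h : ∀ A, MeasurableSet[m] A → Measurable[t] fun a => κ a A) {A : Set X}
    (hA' : MeasurableSet[univCompletion m] A) :
    Measurable[t] fun a => κ a A := by
  intro E hE
  rw [← ht]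
  intro ν hν
  let κ' : T → @Measure X m := fun a => (κ a).trim hm
  have hκ' : Measurable κ' := Measure.measurable_of_measurable_coe _ fun B hB => by
    simpa only [κ', trim_measurableSet_eq hm hB] using h B hB
  have hκp : ∀ a, IsProbabilityMeasure (κ' a) := fun a => prob_trim hm _
  have hJ : IsProbabilityMeasure (ν.bind κ') :=
    @isProbabilityMeasure_bind T X t m ν hν κ' hκ'.aemeasurable (ae_of_all _ hκp)
  obtain ⟨B, hB, hAB⟩ := hA' (ν.bind κ') hJ
  have hnull : ∀ N, ν.bind κ' N = 0 → ∀ᵐ a ∂ν, κ a N = 0 := by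
    intro N hN
    obtain ⟨S, hNS, hS, hS0⟩ := exists_null hN
    have hmeas : Measurable fun a => κ' a S := (Measure.measurable_coe hS).comp hκ'
    rw [Measure.bind_apply hS hκ'.aemeasurable, lintegral_eq_zero_iff hmeas] at hS0
    filter_upwards [hS0] with a ha
    refine measure_mono_null hNS ?_
    exact (trim_measurableSet_eq hm hS).symm.trans ha
  rw [ae_eq_set] at hAB
  have hae : (fun a => κ a A) =ᵐ[ν] fun a => κ a B := by
    filter_upwards [hnull _ hAB.1, hnull _ hAB.2] with a h1 h2
    exact measure_congr (ae_eq_set.2 ⟨h1, h2⟩)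
  exact (AEMeasurable.nullMeasurable ⟨_, h B hB, hae⟩) hE

/-- Measurable maps stay measurable after universal completion. -/
lemma measurable_univCompletion {X : Type u} {Y : Type v} {mX : MeasurableSpace X}
    {mY : MeasurableSpace Y} {f : X → Y} (hf : Measurable[mX, mY] f) :
    Measurable[univCompletion mX, univCompletion mY] f := fun _ hA μ _ =>
  NullMeasurableSet.preimage (hA (μ.map f) (Measure.isProbabilityMeasure_map hf.aemeasurable))
    (hf.quasiMeasurePreserving μ)

/-- The `σ`-algebra `B_Ω` of all universally measurable subsets of the sample space `Ω = ℝ`. -/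
abbrev omegaSigma : MeasurableSpace ℝ := univCompletion (borel ℝ)

/-- A quasi-universal space: a set `X` with a set `Plots` of maps `Ω → X` (written `X^Ω`) that
contains all constant maps and is closed under precomposition with the measurable maps
`(Ω, B_Ω) → (Ω, B_Ω)`. -/
class QUSpace (X : Type u) where
  Plots : Set (ℝ → X)
  comp_mem : ∀ {α : ℝ → X}, α ∈ Plots → ∀ {φ : ℝ → ℝ}, Measurable[omegaSigma, omegaSigma] φ →
    α ∘ φ ∈ Plots
  const_mem : ∀ x : X, (fun _ => x) ∈ Plots

/-- The set of maps `X^Ω`. -/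
abbrev plots (X : Type u) [QUSpace X] : Set (ℝ → X) := QUSpace.Plots

/-- Quasi-measurable maps. -/
def IsQM {X : Type u} {Y : Type v} [QUSpace X] [QUSpace Y] (f : X → Y) : Prop :=
  ∀ α ∈ plots X, f ∘ α ∈ plots Y

/-- The induced `σ`-algebra `B(X^Ω)` of a quasi-universal space. -/
@[reducible] def sigma (X : Type u) [QUSpace X] : MeasurableSpace X where
  MeasurableSet' A := ∀ α ∈ plots X, MeasurableSet[omegaSigma] (α ⁻¹' A)
  measurableSet_empty _ _ := @MeasurableSet.empty ℝ omegaSigma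
  measurableSet_compl _ hA α hα := @MeasurableSet.compl ℝ _ omegaSigma (hA α hα)
  measurableSet_iUnion _ hA α hα := by
    rw [Set.preimage_iUnion]; exact @MeasurableSet.iUnion ℝ ℕ omegaSigma _ _ fun n => hA n α hα

/-- The sample space `Ω = ℝ`, with `Ω^Ω` the set of all `B_Ω`-`B_Ω`-measurable maps. -/
instance instQUSpaceReal : QUSpace ℝ where
  Plots := {φ | Measurable[omegaSigma, omegaSigma] φ}
  comp_mem hα _ hφ := @Measurable.comp ℝ ℝ ℝ omegaSigma omegaSigma omegaSigma _ _ hα hφ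
  const_mem _ := @measurable_const ℝ ℝ omegaSigma omegaSigma _

/-- Binary products. -/
instance instQUSpaceProd {X : Type u} {Y : Type v} [QUSpace X] [QUSpace Y] : QUSpace (X × Y) where
  Plots := {α | (fun ω => (α ω).1) ∈ plots X ∧ (fun ω => (α ω).2) ∈ plots Y}
  comp_mem hα _ hφ := ⟨QUSpace.comp_mem hα.1 hφ, QUSpace.comp_mem hα.2 hφ⟩
  const_mem x := ⟨QUSpace.const_mem x.1, QUSpace.const_mem x.2⟩

/-- The countable power `X^ℕ`. -/
instance instQUSpacePow {X : Type u} [QUSpace X] : QUSpace (ℕ → X) where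
  Plots := {α | ∀ n, (fun ω => α ω n) ∈ plots X}
  comp_mem hα _ hφ n := QUSpace.comp_mem (hα n) hφ
  const_mem x n := QUSpace.const_mem (x n)

lemma sigma_real : sigma ℝ = omegaSigma :=
  le_antisymm (fun _ hA => hA id (@measurable_id ℝ omegaSigma)) (fun _ hA _ hα => hα hA)

lemma plot_isQM {X : Type u} [QUSpace X] {α : ℝ → X} (hα : α ∈ plots X) : IsQM α :=
  fun _ hφ => QUSpace.comp_mem hα hφ

lemma plot_measurable {X : Type u} [QUSpace X] {α : ℝ → X} (hα : α ∈ plots X) :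
    Measurable[omegaSigma, sigma X] α :=
  fun _ hA => hA α hα

lemma IsQM.comp {X : Type u} {Y : Type v} {Z : Type w} [QUSpace X] [QUSpace Y] [QUSpace Z]
    {g : Y → Z} {f : X → Y} (hg : IsQM g) (hf : IsQM f) : IsQM (g ∘ f) :=
  fun α hα => hg (f ∘ α) (hf α hα)

lemma IsQM.measurable {X : Type u} {Y : Type v} [QUSpace X] [QUSpace Y] {f : X → Y}
    (hf : IsQM f) : Measurable[sigma X, sigma Y] f :=
  fun _ hA α hα => hA (f ∘ α) (hf α hα)

/-- A map into a measurable space is measurable if it is so along all plots. -/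
lemma measurable_of_plots {X : Type u} {Y : Type v} [QUSpace X] {mY : MeasurableSpace Y} {f : X → Y}
    (hf : ∀ α ∈ plots X, Measurable[omegaSigma, mY] (f ∘ α)) : Measurable[sigma X, mY] f :=
  fun _ hA α hα => hf α hα hA

/-- All probability measures on `(X, B(X^Ω))`. -/
abbrev ProbG (X : Type u) [QUSpace X] : Type u := @ProbabilityMeasure X (sigma X)

/-- Evaluation of a probability measure, with values in `[0, ∞]`. -/
def ProbG.val {X : Type u} [QUSpace X] (μ : ProbG X) (A : Set X) : ℝ≥0∞ := μ.1 A

lemma ProbG.ext {X : Type u} [QUSpace X] {μ ν : ProbG X}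
    (h : ∀ A, MeasurableSet[sigma X] A → μ.val A = ν.val A) : μ = ν :=
  Subtype.ext (@Measure.ext X (sigma X) _ _ h)

/-- The push-forward of a probability measure along a quasi-measurable map. -/
def ProbG.map {X : Type u} {Y : Type v} [QUSpace X] [QUSpace Y] (f : X → Y) (hf : IsQM f)
    (μ : ProbG X) : ProbG Y :=
  ⟨@Measure.map X Y (sigma X) (sigma Y) f μ.1,
    @Measure.isProbabilityMeasure_map X Y (sigma X) (sigma Y) μ.1 μ.2 f
      (@Measurable.aemeasurable X Y (sigma X) (sigma Y) f μ.1 hf.measurable)⟩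

lemma ProbG.map_val {X : Type u} {Y : Type v} [QUSpace X] [QUSpace Y] {f : X → Y} (hf : IsQM f)
    (μ : ProbG X) {A : Set Y} (hA : MeasurableSet[sigma Y] A) :
    (μ.map f hf).val A = μ.val (f ⁻¹' A) :=
  @Measure.map_apply X Y (sigma X) (sigma Y) μ.1 f hf.measurable A hA

lemma ProbG.map_map {X : Type u} {Y : Type v} {Z : Type w} [QUSpace X] [QUSpace Y] [QUSpace Z]
    {f : X → Y} (hf : IsQM f) {g : Y → Z} (hg : IsQM g) (μ : ProbG X) :
    (μ.map f hf).map g hg = μ.map (g ∘ f) (hg.comp hf) :=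
  ProbG.ext fun A hA => by
    rw [map_val _ _ hA, map_val _ _ (hg.measurable hA), map_val _ _ hA]; rfl

/-- The space `Q(X)`: those probability measures `μ` for which `ω ↦ μ(D_ω)` is measurable for every
`D` in the `σ`-algebra of `Ω × X`. -/
def ProbQ (X : Type u) [QUSpace X] : Type u :=
  {μ : ProbG X // ∀ D : Set (ℝ × X), MeasurableSet[sigma (ℝ × X)] D →
    Measurable[omegaSigma] fun ω => μ.val {x | (ω, x) ∈ D}}

/-- The quasi-universal structure of `Q(X)`. -/
instance instQUSpaceProbQ {X : Type u} [QUSpace X] : QUSpace (ProbQ X) where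
  Plots := {κ | ∀ φ : ℝ → ℝ, Measurable[omegaSigma, omegaSigma] φ → ∀ D : Set (ℝ × X),
    MeasurableSet[sigma (ℝ × X)] D → Measurable[omegaSigma] fun ω =>
      (κ (φ ω)).1.val {x | (ω, x) ∈ D}}
  comp_mem hκ ψ hψ φ hφ D hD :=
    hκ (ψ ∘ φ) (@Measurable.comp ℝ ℝ ℝ omegaSigma omegaSigma omegaSigma _ _ hψ hφ) D hD
  const_mem μ _ _ D hD := μ.2 D hD

/-- The space `P(X)` of push-forward probability measures `α_* μ`, `α ∈ X^Ω`, `μ ∈ Q(Ω)`. -/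
def Prob (X : Type u) [QUSpace X] : Type u :=
  {μ : ProbG X // ∃ (α : ℝ → X) (hα : α ∈ plots X) (ν : ProbQ ℝ),
    μ = ν.1.map α (plot_isQM hα)}

/-- The quasi-universal structure of `P(X)`: its plots are the maps `ω ↦ α_* κ(ω)` with `α ∈ X^Ω` and
`κ ∈ Q(Ω)^Ω`. -/
instance instQUSpaceProb {X : Type u} [QUSpace X] : QUSpace (Prob X) where
  Plots := {ρ | ∃ (α : ℝ → X) (hα : α ∈ plots X) (κ : ℝ → ProbQ ℝ),
    κ ∈ plots (ProbQ ℝ) ∧ ∀ ω, (ρ ω).1 = (κ ω).1.map α (plot_isQM hα)}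
  comp_mem := fun ⟨α, hα, κ, hκ, h⟩ φ hφ =>
    ⟨α, hα, κ ∘ φ, QUSpace.comp_mem hκ hφ, fun ω => h (φ ω)⟩
  const_mem := fun ⟨_, α, hα, ν, h⟩ => ⟨α, hα, fun _ => ν, QUSpace.const_mem ν, fun _ => h⟩

/-- Markov kernels from `Z` to `X`: the elements of `P(X)^Z`, i.e. quasi-measurable maps
`Z → P(X)`. -/
def MarkovKernel (Z : Type v) (X : Type u) [QUSpace Z] [QUSpace X] : Type (max u v) :=
  {K : Z → Prob X // IsQM K}

/-- The probability measure `K(X | Z = z)`. -/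
def MarkovKernel.law {Z : Type v} {X : Type u} [QUSpace Z] [QUSpace X] (K : MarkovKernel Z X)
    (z : Z) : ProbG X := (K.1 z).1

/-- The identity of `P(X)`, as a Markov kernel from `P(X)` to `X`. -/
def MarkovKernel.eval (X : Type u) [QUSpace X] : MarkovKernel (Prob X) X :=
  ⟨id, fun _ hα => hα⟩

lemma sigma_le_of_retract {Y : Type u} [QUSpace Y] {m : MeasurableSpace Y} {i : Y → ℝ}
    (hi : Measurable[m, borel ℝ] i) {r : ℝ → Y} (hr : r ∈ plots Y) (hri : ∀ y, r (i y) = y) :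
    sigma Y ≤ univCompletion m := by
  intro A hA
  have h1 := measurable_univCompletion hi (hA r hr)
  have h3 : i ⁻¹' (r ⁻¹' A) = A := by ext y; simp [hri]
  rwa [h3] at h1

lemma borel_le_omegaSigma : borel ℝ ≤ omegaSigma := le_univCompletion _

lemma plot_of_measurable {φ : ℝ → ℝ} (hφ : Measurable[borel ℝ, borel ℝ] φ) : φ ∈ plots ℝ :=
  measurable_univCompletion hφ

lemma sigma_real_prod_le :
    sigma (ℝ × ℝ) ≤ univCompletion (@Prod.instMeasurableSpace ℝ ℝ (borel ℝ) (borel ℝ)) := by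
  let e : ℝ × ℝ ≃ᵐ ℝ := PolishSpace.measurableEquivOfNotCountable
    (not_countable (α := ℝ × ℝ)) (not_countable (α := ℝ))
  refine sigma_le_of_retract (i := e) e.measurable (r := e.symm) ⟨?_, ?_⟩ e.symm_apply_apply
  · exact plot_of_measurable (measurable_fst.comp e.symm.measurable)
  · exact plot_of_measurable (measurable_snd.comp e.symm.measurable)

lemma prod_le_sigma_real_prod :
    @Prod.instMeasurableSpace ℝ ℝ (borel ℝ) (borel ℝ) ≤ sigma (ℝ × ℝ) := by
  intro A hA α hα
  have h1 : Measurable[omegaSigma, borel ℝ] fun ω => (α ω).1 :=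
    fun B hB => hα.1 (borel_le_omegaSigma _ hB)
  have h2 : Measurable[omegaSigma, borel ℝ] fun ω => (α ω).2 :=
    fun B hB => hα.2 (borel_le_omegaSigma _ hB)
  exact (h1.prodMk h2) hA

/-- For families of probability measures on `Ω`, measurability of evaluations at fixed sets suffices
for belonging to `Q(Ω)^Ω`. -/
lemma measurable_section {κ : ℝ → ProbG ℝ}
    (hκ : ∀ A, MeasurableSet[omegaSigma] A → Measurable[omegaSigma] fun ω => (κ ω).val A)
    {D : Set (ℝ × ℝ)} (hD : MeasurableSet[sigma (ℝ × ℝ)] D) :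
    Measurable[omegaSigma] fun ω => (κ ω).val {x | (ω, x) ∈ D} := by
  have hpair : ∀ ω : ℝ, IsQM (fun x : ℝ => (ω, x)) := fun ω α hα =>
    ⟨QUSpace.const_mem ω, hα⟩
  have hmap : ∀ D : Set (ℝ × ℝ), MeasurableSet[sigma (ℝ × ℝ)] D → ∀ ω,
      ((κ ω).map _ (hpair ω)).val D = (κ ω).val {x | (ω, x) ∈ D} :=
    fun D hD ω => ProbG.map_val (hpair ω) _ hD
  simp only [← hmap D hD]
  refine measurable_of_completion (univCompletion_idem _) prod_le_sigma_real_prod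
    (fun ω => ((κ ω).map _ (hpair ω)).1) (fun ω => ((κ ω).map _ (hpair ω)).2) ?_
    (sigma_real_prod_le _ hD)
  intro A hA
  have hle : borel ℝ ≤ sigma ℝ := by rw [sigma_real]; exact borel_le_omegaSigma
  let κ' : @ProbabilityTheory.Kernel ℝ ℝ omegaSigma (borel ℝ) :=
    @ProbabilityTheory.Kernel.mk ℝ ℝ omegaSigma (borel ℝ) (fun ω => (κ ω).1.trim hle)
      (@Measure.measurable_of_measurable_coe ℝ ℝ (borel ℝ) omegaSigma _ fun B hB => by
        have := hκ B (borel_le_omegaSigma _ hB)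
        simpa only [trim_measurableSet_eq hle hB] using! this)
  have hprob : ∀ ω, @IsProbabilityMeasure ℝ (borel ℝ) (κ' ω) := fun ω =>
    @prob_trim ℝ (borel ℝ) (sigma ℝ) hle (κ ω).1 (κ ω).2
  have hmk : @ProbabilityTheory.IsMarkovKernel ℝ ℝ omegaSigma (borel ℝ) κ' :=
    @ProbabilityTheory.IsMarkovKernel.mk ℝ ℝ omegaSigma (borel ℝ) κ' hprob
  have hA' : MeasurableSet[@Prod.instMeasurableSpace ℝ ℝ omegaSigma (borel ℝ)] A :=
    (sup_le_sup (MeasurableSpace.comap_mono borel_le_omegaSigma) le_rfl :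
      @Prod.instMeasurableSpace ℝ ℝ (borel ℝ) (borel ℝ) ≤
      @Prod.instMeasurableSpace ℝ ℝ omegaSigma (borel ℝ)) _ hA
  have key := @ProbabilityTheory.Kernel.measurable_kernel_prodMk_left ℝ ℝ omegaSigma (borel ℝ) κ'
    inferInstance A hA'
  convert key using 2 with ω
  rw [show (@DFunLike.coe _ _ _ _ ((κ ω).map _ (hpair ω)).1 A) = ((κ ω).map _ (hpair ω)).val A from rfl,
    hmap A (prod_le_sigma_real_prod _ hA) ω]
  exact (trim_measurableSet_eq hle (@measurable_prodMk_left ℝ ℝ (borel ℝ) (borel ℝ) ω _ hA)).symm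

lemma exists_plot_ProbQ {κ : ℝ → ProbG ℝ}
    (hκ : ∀ A, MeasurableSet[omegaSigma] A → Measurable[omegaSigma] fun ω => (κ ω).val A) :
    ∃ κ' ∈ plots (ProbQ ℝ), ∀ ω, (κ' ω).1 = κ ω := by
  refine ⟨fun ω => ⟨κ ω, fun D hD => ?_⟩, fun φ hφ D hD => ?_, fun _ => rfl⟩
  · exact measurable_section (κ := fun _ => κ ω)
      (fun _ _ => @measurable_const ℝ≥0∞ ℝ _ omegaSigma _) hD
  · exact measurable_section (κ := fun ω => κ (φ ω))
      (fun A hA => @Measurable.comp ℝ ℝ ℝ≥0∞ omegaSigma omegaSigma _ _ _ (hκ A hA) hφ) hD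

lemma plot_ProbQ_measurable {κ : ℝ → ProbQ ℝ} (hκ : κ ∈ plots (ProbQ ℝ)) {A : Set ℝ}
    (hA : MeasurableSet[omegaSigma] A) : Measurable[omegaSigma] fun ω => (κ ω).1.val A :=
  hκ id (@measurable_id ℝ omegaSigma) (Prod.snd ⁻¹' A) fun _ hα => hα.2 hA

lemma plot_Prob_measurable {X : Type u} [QUSpace X] {ρ : ℝ → Prob X} (hρ : ρ ∈ plots (Prob X))
    {A : Set X} (hA : MeasurableSet[sigma X] A) :
    Measurable[omegaSigma] fun ω => (ρ ω).1.val A := by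
  obtain ⟨α, hα, κ, hκ, h⟩ := hρ
  simp only [h, ProbG.map_val _ _ hA]
  exact plot_ProbQ_measurable hκ (hA α hα)

/-- A family of probability measures on `X` that is given along all plots of `Z` by plots of `P(X)`
is a Markov kernel. -/
def MarkovKernel.mk {Z : Type v} {X : Type u} [QUSpace Z] [QUSpace X] (f : Z → ProbG X)
    (h : ∀ γ ∈ plots Z, ∃ (α : ℝ → X) (hα : α ∈ plots X) (κ : ℝ → ProbQ ℝ), κ ∈ plots (ProbQ ℝ) ∧
      ∀ ω, f (γ ω) = (κ ω).1.map α (plot_isQM hα)) : MarkovKernel Z X :=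
  ⟨fun z => ⟨f z, by
    obtain ⟨α, hα, κ, -, h⟩ := h _ (QUSpace.const_mem z)
    exact ⟨α, hα, κ 0, h 0⟩⟩, h⟩

lemma MarkovKernel.measurable {S : Type v} {X : Type u} [QUSpace S] [QUSpace X]
    (K : MarkovKernel S X) {A : Set X} (hA : MeasurableSet[sigma X] A) :
    Measurable[sigma S] fun s => (K.law s).val A :=
  measurable_of_plots fun _ hβ => plot_Prob_measurable (K.2 _ hβ) hA

lemma MarkovKernel.measurable_law {S : Type v} {X : Type u} [QUSpace S] [QUSpace X]
    (K : MarkovKernel S X) :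
    @Measurable S (@Measure X (sigma X)) (sigma S) (@Measure.instMeasurableSpace X (sigma X))
      fun s => (K.law s).1 :=
  @Measure.measurable_of_measurable_coe X S (sigma X) (sigma S) _ fun _ hA => K.measurable hA

/-- The mixture `A ↦ ∫ K(X ∈ A | S = s) μ(ds)`. -/
def MarkovKernel.bind {S : Type v} {X : Type u} [QUSpace S] [QUSpace X]
    (K : MarkovKernel S X) (μ : ProbG S) : ProbG X :=
  ⟨@Measure.bind S X (sigma S) (sigma X) μ.1 fun s => (K.law s).1,
    @isProbabilityMeasure_bind S X (sigma S) (sigma X) μ.1 μ.2 _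
      K.measurable_law.aemeasurable (Filter.Eventually.of_forall fun s => (K.law s).2)⟩

lemma MarkovKernel.bind_val {S : Type v} {X : Type u} [QUSpace S] [QUSpace X]
    (K : MarkovKernel S X) (μ : ProbG S) {A : Set X} (hA : MeasurableSet[sigma X] A) :
    (K.bind μ).val A = @lintegral S (sigma S) μ.1 fun s => (K.law s).val A :=
  @Measure.bind_apply S X (sigma S) (sigma X) μ.1 _ A hA K.measurable_law.aemeasurable

/-- The composition `K(X|S) ∘ P(S|Z)`, `(X ∈ A, Z = z) ↦ ∫ K(X ∈ A | S = s) P(S ∈ ds | Z = z)`. -/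
def MarkovKernel.comp {Z : Type w} {S : Type v} {X : Type u} [QUSpace Z] [QUSpace S] [QUSpace X]
    (K : MarkovKernel S X) (P : MarkovKernel Z S) : MarkovKernel Z X :=
  MarkovKernel.mk (fun z => K.bind (P.law z)) <| by
    intro γ hγ
    obtain ⟨β, hβ, κ, hκ, hP⟩ := P.2 γ hγ
    obtain ⟨α, hα, lam, hlam, hK⟩ := K.2 β hβ
    have hβm := plot_measurable hβ
    let lamG : ℝ → @Measure ℝ (sigma ℝ) := fun ω => (lam ω).1.1
    have hlamG : @Measurable ℝ (@Measure ℝ (sigma ℝ)) (sigma ℝ) _ lamG :=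
      @Measure.measurable_of_measurable_coe ℝ ℝ (sigma ℝ) (sigma ℝ) _ fun A hA => by
        rw [sigma_real] at hA
        have := plot_ProbQ_measurable hlam hA
        exact fun B hB => sigma_real.ge _ (this hB)
    let ρ : ℝ → ProbG ℝ := fun ω =>
      ⟨@Measure.bind ℝ ℝ (sigma ℝ) (sigma ℝ) (κ ω).1.1 lamG,
        @isProbabilityMeasure_bind ℝ ℝ (sigma ℝ) (sigma ℝ) (κ ω).1.1 (κ ω).1.2 _
          hlamG.aemeasurable (Filter.Eventually.of_forall fun s => (lam s).1.2)⟩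
    have hρval : ∀ ω A, MeasurableSet[sigma ℝ] A →
        (ρ ω).val A = @lintegral ℝ (sigma ℝ) (κ ω).1.1 fun s => (lam s).1.val A := fun ω A hA =>
      @Measure.bind_apply ℝ ℝ (sigma ℝ) (sigma ℝ) (κ ω).1.1 _ A hA hlamG.aemeasurable
    obtain ⟨κ', hκ', hκρ⟩ := exists_plot_ProbQ (κ := ρ) <| by
      intro A hA
      have hA' : MeasurableSet[sigma ℝ] A := by rwa [sigma_real]
      simp only [hρval _ A hA']
      have h1 : Measurable[sigma ℝ] fun s => (lam s).1.val A := by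
        rw [sigma_real]; exact plot_ProbQ_measurable hlam hA
      have h2 : @Measurable ℝ (@Measure ℝ (sigma ℝ)) omegaSigma _ fun ω => (κ ω).1.1 :=
        @Measure.measurable_of_measurable_coe ℝ ℝ (sigma ℝ) omegaSigma _ fun B hB => by
          rw [sigma_real] at hB
          exact plot_ProbQ_measurable hκ hB
      exact @Measurable.comp ℝ _ _ omegaSigma _ _ _ _ (Measure.measurable_lintegral h1) h2
    refine ⟨α, hα, κ', hκ', fun ω => ProbG.ext fun A hA => ?_⟩
    rw [hκρ, ProbG.map_val _ _ hA, hρval _ _ ((plot_isQM hα).measurable hA), K.bind_val _ hA]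
    have hPω : P.law (γ ω) = (κ ω).1.map β (plot_isQM hβ) := hP ω
    rw [hPω]
    refine (@lintegral_map ℝ S (sigma ℝ) (sigma S) (κ ω).1.1 _ _ (K.measurable hA)
      (plot_isQM hβ).measurable).trans ?_
    refine lintegral_congr fun s => ?_
    have hKs : K.law (β s) = (lam s).1.map α (plot_isQM hα) := hK s
    rw [hKs, ProbG.map_val _ _ hA]

/-- Universal measurable spaces: after universal completion, isomorphic to a universally measurable
subset of `ℝ` with the universally measurable subsets. -/
def IsUniversalMeasurable {X : Type u} (m : MeasurableSpace X) : Prop :=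
  ∃ Z : Set ℝ, MeasurableSet[omegaSigma] Z ∧
    Nonempty (@MeasurableEquiv X Z (univCompletion m) (omegaSigma.comap Subtype.val))

/-- Universal quasi-universal spaces: `(X, B(X^Ω))` is a universal measurable space, and `X^Ω` consists
of all measurable maps `(Ω, B_Ω) → (X, B(X^Ω))`. -/
def IsUniversal (X : Type u) [QUSpace X] : Prop :=
  IsUniversalMeasurable (sigma X) ∧ plots X = {α | Measurable[omegaSigma, sigma X] α}

lemma univCompletion_sigma (X : Type u) [QUSpace X] : univCompletion (sigma X) = sigma X := by
  refine le_antisymm (fun A hA α hα => ?_) (le_univCompletion _)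
  have h1 := measurable_univCompletion (plot_measurable hα) hA
  rwa [univCompletion_idem] at h1

lemma IsUniversal.exists_retract {X : Type u} [QUSpace X] (hX : IsUniversal X) (x₀ : X) :
    ∃ (i : X → ℝ) (r : ℝ → X), Measurable[sigma X, borel ℝ] i ∧ r ∈ plots X ∧
      ∀ x, r (i x) = x := by
  classical
  obtain ⟨⟨Z, hZ, ⟨e'⟩⟩, hplots⟩ := hX
  obtain ⟨e, he, he'⟩ : ∃ e : X ≃ Z,
      Measurable[univCompletion (sigma X), omegaSigma.comap Subtype.val] e ∧
      Measurable[omegaSigma.comap Subtype.val, univCompletion (sigma X)] e.symm :=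
    ⟨@MeasurableEquiv.toEquiv _ _ (_) (_) e', @MeasurableEquiv.measurable_toFun _ _ (_) (_) e',
      @MeasurableEquiv.measurable_invFun _ _ (_) (_) e'⟩
  rw [univCompletion_sigma] at he he'
  refine ⟨fun x => (e x : ℝ), fun ω => if h : ω ∈ Z then e.symm ⟨ω, h⟩ else x₀, ?_, ?_, ?_⟩
  · intro B hB
    exact he ⟨B, borel_le_omegaSigma _ hB, rfl⟩
  · rw [hplots]
    intro A hA
    obtain ⟨B, hB, hBA⟩ := he' hA
    have : (fun ω => if h : ω ∈ Z then e.symm ⟨ω, h⟩ else x₀) ⁻¹' A =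
        (B ∩ Z) ∪ (Zᶜ ∩ {_ω | x₀ ∈ A}) := by
      ext ω
      by_cases h : ω ∈ Z
      · have h2 : (⟨ω, h⟩ : Z) ∈ Subtype.val ⁻¹' B ↔ (⟨ω, h⟩ : Z) ∈ e.symm ⁻¹' A := by
          rw [hBA]
        simp only [Set.mem_preimage] at h2
        simp [h, h2]
      · simp [h]
    rw [this]
    have hc : MeasurableSet[omegaSigma] {_ω : ℝ | x₀ ∈ A} := @MeasurableSet.const ℝ omegaSigma _
    exact @MeasurableSet.union ℝ omegaSigma _ _ (@MeasurableSet.inter ℝ omegaSigma _ _ hB hZ)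
      (@MeasurableSet.inter ℝ omegaSigma _ _ (@MeasurableSet.compl ℝ _ omegaSigma hZ) hc)
  · intro x
    simp

/-- The product `σ`-algebra of the `σ`-algebras of the factors of `X^ℕ`. -/
abbrev piSigma (X : Type u) [QUSpace X] : MeasurableSpace (ℕ → X) :=
  @MeasurableSpace.pi ℕ (fun _ => X) fun _ => sigma X

lemma piSigma_le (X : Type u) [QUSpace X] : piSigma X ≤ sigma (ℕ → X) := by
  refine iSup_le fun n => ?_
  rintro _ ⟨B, hB, rfl⟩ α hα
  exact hB _ (hα n)

lemma uncountable_seq : Uncountable (ℕ → ℝ) :=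
  Function.Injective.uncountable (f := fun (x : ℝ) (_ : ℕ) => x) fun _ _ h => congrFun h 0

/-- A Borel isomorphism between `ℝ^ℕ` and `ℝ`. -/
def seqEquiv : (ℕ → ℝ) ≃ᵐ ℝ :=
  PolishSpace.measurableEquivOfNotCountable (@not_countable (ℕ → ℝ) uncountable_seq) (not_countable (α := ℝ))

lemma seqEquiv_symm_mem : (seqEquiv.symm : ℝ → ℕ → ℝ) ∈ plots (ℕ → ℝ) := fun n =>
  plot_of_measurable ((measurable_pi_apply n).comp seqEquiv.symm.measurable)

lemma sigma_pow_le_of_retract {X : Type u} [QUSpace X] {i : X → ℝ} {r : ℝ → X}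
    (hi : Measurable[sigma X, borel ℝ] i) (hr : r ∈ plots X) (hri : ∀ x, r (i x) = x) :
    sigma (ℕ → X) ≤ univCompletion (piSigma X) := by
  refine sigma_le_of_retract (i := fun x => seqEquiv fun n => i (x n)) ?_
    (r := fun ω n => r (seqEquiv.symm ω n)) (fun n => ?_) fun x => ?_
  · let _ := sigma X
    exact seqEquiv.measurable.comp
      (measurable_pi_lambda _ fun n => hi.comp (measurable_pi_apply n))
  · exact plot_isQM hr _ (seqEquiv_symm_mem n)
  · simp [hri]

/-- On the countable power of a universal space, the induced `σ`-algebra lies between the product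
`σ`-algebra and its universal completion. -/
lemma IsUniversal.sigma_pow_le {X : Type u} [QUSpace X] (hX : IsUniversal X) :
    sigma (ℕ → X) ≤ univCompletion (piSigma X) := by
  rcases isEmpty_or_nonempty X with h | ⟨⟨x₀⟩⟩
  · intro A _
    rw [Set.eq_empty_of_isEmpty A]
    exact @MeasurableSet.empty _ (univCompletion (piSigma X))
  · obtain ⟨i, r, hi, hr, hri⟩ := hX.exists_retract x₀
    exact sigma_pow_le_of_retract hi hr hri

lemma sigma_pow_real_le : sigma (ℕ → ℝ) ≤ univCompletion (piSigma ℝ) :=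
  sigma_pow_le_of_retract (i := id) (r := id)
    (by rw [sigma_real]; exact fun _ hB => borel_le_omegaSigma _ hB)
    (@measurable_id ℝ omegaSigma) fun _ => rfl

/-- The product `⊗_n μ_n` of a sequence of probability measures on `X`, as a probability measure on
the `σ`-algebra of `X^ℕ`. -/
def prodG {X : Type u} [QUSpace X] (h : sigma (ℕ → X) ≤ univCompletion (piSigma X))
    (μ : ℕ → ProbG X) : ProbG (ℕ → X) :=
  have hp := @Measure.instIsProbabilityMeasureForallInfinitePi ℕ (fun _ => X) (fun _ => sigma X)
    (fun n => (μ n).1) (fun n => (μ n).2)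
  ⟨extend (sigma (ℕ → X))
      (@Measure.infinitePi ℕ (fun _ => X) (fun _ => sigma X) fun n => (μ n).1)
      fun A hA => h A hA _ hp,
    extend_prob _ hp⟩

lemma prodG_val {X : Type u} [QUSpace X] (h : sigma (ℕ → X) ≤ univCompletion (piSigma X))
    (μ : ℕ → ProbG X) {A : Set (ℕ → X)} (hA : MeasurableSet[sigma (ℕ → X)] A) :
    (prodG h μ).val A =
      @Measure.infinitePi ℕ (fun _ => X) (fun _ => sigma X) (fun n => (μ n).1) A := by
  have hp := @Measure.instIsProbabilityMeasureForallInfinitePi ℕ (fun _ => X) (fun _ => sigma X)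
    (fun n => (μ n).1) (fun n => (μ n).2)
  exact extend_apply (fun A hA => h A hA _ hp) hA

lemma prodG_pi {X : Type u} [QUSpace X] (h : sigma (ℕ → X) ≤ univCompletion (piSigma X))
    (μ : ℕ → ProbG X) (s : Finset ℕ) (t : ℕ → Set X) (ht : ∀ n, MeasurableSet[sigma X] (t n)) :
    (prodG h μ).val (Set.pi s t) = ∏ n ∈ s, (μ n).val (t n) := by
  let _ := sigma X
  have : ∀ n, IsProbabilityMeasure (μ n).1 := fun n => (μ n).2
  have hm : MeasurableSet[piSigma X] (Set.pi (s : Set ℕ) t) :=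
    MeasurableSet.pi s.countable_toSet fun n _ => ht n
  refine (prodG_val h μ (piSigma_le X _ hm)).trans ?_
  exact Measure.infinitePi_pi (fun n => (μ n).1) fun n _ => ht n

lemma eq_prodG {X : Type u} [QUSpace X] (h : sigma (ℕ → X) ≤ univCompletion (piSigma X))
    (μ : ℕ → ProbG X) (ν : ProbG (ℕ → X))
    (hν : ∀ (s : Finset ℕ) (t : ℕ → Set X), (∀ n, MeasurableSet[sigma X] (t n)) →
      ν.val (Set.pi s t) = ∏ n ∈ s, (μ n).val (t n)) : ν = prodG h μ := by
  let _ := sigma X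
  have : ∀ n, IsProbabilityMeasure (μ n).1 := fun n => (μ n).2
  have hm : ∀ (s : Finset ℕ) (t : ℕ → Set X), (∀ n, MeasurableSet[sigma X] (t n)) →
      MeasurableSet[piSigma X] (Set.pi (s : Set ℕ) t) := fun s t ht =>
    MeasurableSet.pi s.countable_toSet fun n _ => ht n
  have key : ν.1.trim (piSigma_le X) = Measure.infinitePi fun n => (μ n).1 :=
    Measure.eq_infinitePi _ fun s t ht => by
      rw [trim_measurableSet_eq (piSigma_le X) (hm s t ht)]
      exact hν s t ht
  refine Subtype.ext (@eq_of_eq_on _ _ _ (piSigma_le X) h ν.1 (prodG h μ).1 ν.2 fun A hA => ?_)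
  rw [← trim_measurableSet_eq (piSigma_le X) hA, key]
  exact (prodG_val h μ (piSigma_le X _ hA)).symm

lemma isQM_pow {X : Type u} {Y : Type v} [QUSpace X] [QUSpace Y] {f : ℕ → X → Y}
    (hf : ∀ n, IsQM (f n)) : IsQM fun (x : ℕ → X) n => f n (x n) :=
  fun _ hα n => hf n _ (hα n)

lemma prodG_map {X : Type u} {Y : Type v} [QUSpace X] [QUSpace Y]
    (hX : sigma (ℕ → X) ≤ univCompletion (piSigma X))
    (hY : sigma (ℕ → Y) ≤ univCompletion (piSigma Y)) {f : ℕ → X → Y} (hf : ∀ n, IsQM (f n))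
    (μ : ℕ → ProbG X) :
    (prodG hX μ).map _ (isQM_pow hf) = prodG hY fun n => (μ n).map (f n) (hf n) := by
  refine eq_prodG _ _ _ fun s t ht => ?_
  have hm : MeasurableSet[sigma (ℕ → Y)] (Set.pi (s : Set ℕ) t) := by
    let _ := sigma Y
    exact piSigma_le Y _ (MeasurableSet.pi s.countable_toSet fun n _ => ht n)
  rw [ProbG.map_val _ _ hm]
  simp only [ProbG.map_val _ _ (ht _)]
  exact prodG_pi hX μ s (fun n => f n ⁻¹' t n) fun n => (hf n).measurable (ht n)

lemma prodG_measurable {X : Type u} [QUSpace X]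
    (h : sigma (ℕ → X) ≤ univCompletion (piSigma X)) {κ : ℕ → ℝ → ProbG X}
    (hκ : ∀ n A, MeasurableSet[sigma X] A → Measurable[omegaSigma] fun ω => (κ n ω).val A)
    {D : Set (ℕ → X)} (hD : MeasurableSet[sigma (ℕ → X)] D) :
    Measurable[omegaSigma] fun ω => (prodG h fun n => κ n ω).val D := by
  have hp : ∀ ω, @IsProbabilityMeasure _ (piSigma X)
      ((prodG h fun n => κ n ω).1.trim (piSigma_le X)) := fun ω =>
    @prob_trim _ _ _ (piSigma_le X) _ (prodG h fun n => κ n ω).2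
  have hm : @Measurable ℝ (@Measure _ (piSigma X)) omegaSigma
      (@Measure.instMeasurableSpace _ (piSigma X))
      fun ω => (prodG h fun n => κ n ω).1.trim (piSigma_le X) := by
    let _ := sigma X
    refine @Measurable.measure_of_isPiSystem_of_isProbabilityMeasure ℝ _ omegaSigma (piSigma X) _ hp
      _ generateFrom_squareCylinders.symm
      (isPiSystem_squareCylinders (fun _ => MeasurableSpace.isPiSystem_measurableSet)
        fun _ => (MeasurableSet.univ : MeasurableSet[sigma X] Set.univ)) ?_
    rintro _ ⟨s, t, ht, rfl⟩
    have ht' : ∀ n, MeasurableSet[sigma X] (t n) := fun n => ht n (Set.mem_univ n)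
    have hmp : MeasurableSet[piSigma X] (Set.pi (s : Set ℕ) t) :=
      MeasurableSet.pi s.countable_toSet fun n _ => ht' n
    have : ∀ ω, ((prodG h fun n => κ n ω).1.trim (piSigma_le X)) (Set.pi (s : Set ℕ) t) =
        ∏ n ∈ s, (κ n ω).val (t n) := fun ω =>
      (trim_measurableSet_eq (piSigma_le X) hmp).trans (prodG_pi h _ s t ht')
    simp only [this]
    exact Finset.measurable_fun_prod s fun n _ => hκ n _ (ht' n)
  refine measurable_of_completion (univCompletion_idem _) (piSigma_le X)
    (fun ω => (prodG h fun n => κ n ω).1) (fun ω => (prodG h fun n => κ n ω).2) ?_ (h _ hD)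
  intro A hA
  have := @Measurable.comp ℝ _ _ omegaSigma _ _ _ _
    (@Measure.measurable_coe _ (piSigma X) A hA) hm
  simpa only [Function.comp_def, trim_measurableSet_eq (piSigma_le X) hA] using! this

/-- The product kernel `⊗_n K_n(X_n|S)` of a sequence of Markov kernels from `S` to a universal
space `X`. -/
def MarkovKernel.prod {S : Type v} {X : Type u} [QUSpace S] [QUSpace X] (hX : IsUniversal X)
    (K : ℕ → MarkovKernel S X) : MarkovKernel S (ℕ → X) :=
  MarkovKernel.mk (fun s => prodG hX.sigma_pow_le fun n => (K n).law s) <| by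
    intro β hβ
    choose α hα κ hκ hK using fun n => (K n).2 β hβ
    have hθ : IsQM (seqEquiv : (ℕ → ℝ) → ℝ) := fun φ hφ => by
      have h1 : Measurable[omegaSigma, MeasurableSpace.pi] φ :=
        @measurable_pi_lambda ℝ ℕ (fun _ => ℝ) omegaSigma _ φ fun n _ hB => hφ n (borel_le_omegaSigma _ hB)
      have h2 := measurable_univCompletion (seqEquiv.measurable.comp h1)
      rwa [univCompletion_idem] at h2
    let ρ : ℝ → ProbG ℝ := fun ω =>
      (prodG sigma_pow_real_le fun n => (κ n ω).1).map seqEquiv hθ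
    obtain ⟨κ', hκ', hκρ⟩ := exists_plot_ProbQ (κ := ρ) <| by
      intro A hA
      have hA' : MeasurableSet[sigma ℝ] A := by rwa [sigma_real]
      simp only [ρ, ProbG.map_val hθ _ hA']
      refine prodG_measurable sigma_pow_real_le (κ := fun n ω => (κ n ω).1) (fun n B hB => ?_)
        (hθ.measurable hA')
      rw [sigma_real] at hB
      exact plot_ProbQ_measurable (hκ n) hB
    have hα' : (fun ω n => α n (seqEquiv.symm ω n)) ∈ plots (ℕ → X) := fun n =>
      plot_isQM (hα n) _ (seqEquiv_symm_mem n)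
    refine ⟨_, hα', κ', hκ', fun ω => ?_⟩
    have hKω : ∀ n, (K n).law (β ω) = (κ n ω).1.map (α n) (plot_isQM (hα n)) := fun n => hK n ω
    simp only [hKω, hκρ]
    rw [← prodG_map sigma_pow_real_le _ fun n => plot_isQM (hα n)]
    simp only [ρ, ProbG.map_map]
    congr 1
    ext x n
    simp

lemma isQM_reindex {X : Type u} [QUSpace X] (σ : ℕ → ℕ) :
    IsQM fun (x : ℕ → X) (n : ℕ) => x (σ n) :=
  fun _ hα n => hα (σ n)

/-- Exchangeability: invariance of `Q(X_ℕ | Z = z)` under all finite permutations of the index set. -/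
def IsExchangeable {Z : Type v} {X : Type u} [QUSpace Z] [QUSpace X]
    (Q : MarkovKernel Z (ℕ → X)) : Prop :=
  ∀ σ : Equiv.Perm ℕ, {n | σ n ≠ n}.Finite → ∀ z : Z,
    (Q.law z).map (fun x n => x (σ n)) (isQM_reindex σ) = Q.law z

end

end QUS

/-!
The mixing kernel comes from one map that depends on nothing: `empLaw` sends a real sequence to the
probability measure with the limiting empirical frequencies, or to a default value where these (taken as
upper limits) are not the values of a probability measure on the rational half-lines. It is Borel
measurable, and for *every* exchangeable law `P` on `ℝ^ℕ` the mixture of the product measures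
`empLaw x ⊗ empLaw x ⊗ ⋯` over `P(dx)` is `P` itself. Since the map does not depend on `P`, it can be
applied to all the laws `Q(X_ℕ | Z = z)` at once: `P(S | Z)` is the push-forward of `Q(X_ℕ | Z)` along a
quasi-measurable map `X^ℕ → P(X)`, and a push-forward of a Markov kernel along such a map is a Markov
kernel. No measurable choice in `z` is needed.

The classical part is done for the Borel `σ`-algebra.
* Under an exchangeable law, the averages of the first `4 ^ k` values `f (x i)` converge almost surely
  (`IsSwapInvariant.tendsto_empMean`), because the second moments of their increments are `O(4 ^ (-k))`.
* If `G` is unchanged when coordinate `j` is swapped with any sufficiently late one, then `f (x j)` can be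
  replaced by the limit of the averages in the integral of `f (x j) * G x`
  (`IsSwapInvariant.integral_mul_limMean`). Replacing the factors of a product one after another gives
  the formula of de Finetti (`IsSwapInvariant.integral_prod_eq`). With indicators of exchangeable events
  for `G`, it identifies the limit with a conditional expectation
  (`IsSwapInvariant.limMean_ae_eq_condExp`).
* A regular conditional distribution given the exchangeable `σ`-algebra then shows that the limiting
  frequencies are almost surely the values of a probability measure, namely of `empLaw`
  (`IsSwapInvariant.empLaw_real`).

Both sides of the resulting identity are probability measures, so it extends from Borel sets to the
larger `σ`-algebra of the quasi-universal space `ℝ^ℕ` (`IsSwapInvariantG.eq_bind_real`), and a nonempty universal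
space is a quasi-measurable retract of `ℝ` (`IsSwapInvariantG.eq_bind`).

Conversely a mixture of the measures `μ ⊗ μ ⊗ ⋯` is exchangeable, as each of them is
(`isExchangeable_prod_comp`).
-/

namespace QUS

open ProbabilityTheory Filter Topology Finset

/-! ### Empirical means under an exchangeable law -/

/-- Exchangeability of a measure on a sequence space, in terms of transpositions. -/
def IsSwapInvariant {Y : Type u} [MeasurableSpace Y] (P : Measure (ℕ → Y)) : Prop :=
  ∀ i j, MeasurePreserving (fun (x : ℕ → Y) n => x (Equiv.swap i j n)) P P

/-- The mean of `f` over the first `n` terms of a sequence. -/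
noncomputable def empMean {Y : Type u} (f : Y → ℝ) (n : ℕ) (x : ℕ → Y) : ℝ :=
  (n : ℝ)⁻¹ * ∑ i ∈ range n, f (x i)

/-- The limit of the means of `f` along a sequence. The subsequence `4 ^ k` is sparse enough for almost
sure convergence to follow from second moments; as an upper limit, `limMean f` is everywhere defined,
measurable, and exactly invariant under transpositions. -/
noncomputable def limMean {Y : Type u} (f : Y → ℝ) (x : ℕ → Y) : ℝ :=
  limsup (fun k : ℕ => empMean f (4 ^ k) x) atTop

section
variable {Y : Type u} {f : Y → ℝ}

lemma empMean_mem_Icc (hf : ∀ y, f y ∈ Set.Icc (0 : ℝ) 1) (n : ℕ) (x : ℕ → Y) :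
    empMean f n x ∈ Set.Icc (0 : ℝ) 1 := by
  have h0 : 0 ≤ ∑ i ∈ range n, f (x i) := sum_nonneg fun i _ => (hf _).1
  have h1 : ∑ i ∈ range n, f (x i) ≤ n := by
    simpa using sum_le_card_nsmul (range n) (fun i => f (x i)) 1 fun i _ => (hf _).2
  refine ⟨by unfold empMean; positivity, ?_⟩
  unfold empMean
  rw [inv_mul_eq_div]
  exact div_le_one_of_le₀ h1 (by positivity)

lemma limMean_swap (f : Y → ℝ) (i j : ℕ) (x : ℕ → Y) :
    limMean f (fun n => x (Equiv.swap i j n)) = limMean f x := by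
  refine limsup_congr ?_
  -- a mean over more than `max i j` terms is not affected by the swap
  have h4 : Tendsto (fun k : ℕ => 4 ^ k) atTop atTop := tendsto_pow_atTop_atTop_of_one_lt (by simp)
  filter_upwards [h4.eventually_gt_atTop i, h4.eventually_gt_atTop j] with k hi hj
  unfold empMean
  congr 1
  refine sum_equiv (Equiv.swap i j) (fun n => ?_) fun _ _ => rfl
  simp only [mem_range, Equiv.swap_apply_def]
  split_ifs <;> simp_all

variable [MeasurableSpace Y]

lemma measurable_empMean (hf : Measurable f) (n : ℕ) : Measurable (empMean f n) := by
  unfold empMean; fun_prop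

lemma measurable_limMean (hf : Measurable f) : Measurable (limMean f) :=
  Measurable.limsup fun k => measurable_empMean hf (4 ^ k)

variable {P : Measure (ℕ → Y)}

lemma IsSwapInvariant.integral_comp (hP : IsSwapInvariant P) (i j : ℕ) {G : (ℕ → Y) → ℝ}
    (hG : Measurable G) : ∫ x, G (fun n => x (Equiv.swap i j n)) ∂P = ∫ x, G x ∂P := by
  rw [← integral_map (hP i j).measurable.aemeasurable hG.aestronglyMeasurable, (hP i j).map_eq]

lemma IsSwapInvariant.integral_mul_eq (hP : IsSwapInvariant P) (hf : Measurable f) {i j k l : ℕ}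
    (hij : i ≠ j) (hkl : k ≠ l) :
    ∫ x, f (x i) * f (x j) ∂P = ∫ x, f (x k) * f (x l) ∂P := by
  have move : ∀ {a b c : ℕ}, a ≠ b → a ≠ c →
      ∫ x, f (x a) * f (x b) ∂P = ∫ x, f (x a) * f (x c) ∂P := by
    intro a b c hab hac
    have := hP.integral_comp b c (G := fun x => f (x a) * f (x c)) (by fun_prop)
    simpa [Equiv.swap_apply_of_ne_of_ne hab hac] using this
  have comm : ∀ a b, ∫ x, f (x a) * f (x b) ∂P = ∫ x, f (x b) * f (x a) ∂P := fun a b => by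
    simp only [mul_comm]
  -- an index distinct from the four given ones serves as an intermediate position
  let m := i + j + k + l + 1
  calc _ = ∫ x, f (x i) * f (x m) ∂P := move hij (by omega)
    _ = ∫ x, f (x m) * f (x i) ∂P := comm _ _
    _ = ∫ x, f (x m) * f (x k) ∂P := move (by omega) (by omega)
    _ = ∫ x, f (x k) * f (x m) ∂P := comm _ _
    _ = _ := move (by omega) hkl

lemma IsSwapInvariant.integral_sq_eq (hP : IsSwapInvariant P) (hf : Measurable f) (i j : ℕ) :
    ∫ x, f (x i) * f (x i) ∂P = ∫ x, f (x j) * f (x j) ∂P := by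
  simpa using hP.integral_comp i j (G := fun x => f (x j) * f (x j)) (by fun_prop)

variable [IsProbabilityMeasure P]

lemma integrable_of_mem_Icc {G : (ℕ → Y) → ℝ} (hG : Measurable G) {C : ℝ}
    (h : ∀ x, |G x| ≤ C) : Integrable G P :=
  Integrable.of_bound hG.aestronglyMeasurable C (ae_of_all _ h)

/-- The `f (x i)` have a common second moment and common mixed moments; since the weights sum to zero,
only the diagonal contributes. -/
lemma IsSwapInvariant.integral_weighted_sq_le (hP : IsSwapInvariant P) (hf : Measurable f)
    (hf01 : ∀ y, f y ∈ Set.Icc (0 : ℝ) 1) {n : ℕ} {w : ℕ → ℝ} (hw : ∑ i ∈ range n, w i = 0) :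
    ∫ x, (∑ i ∈ range n, w i * f (x i)) ^ 2 ∂P ≤ ∑ i ∈ range n, w i ^ 2 := by
  let c : ℕ → ℕ → ℝ := fun i j => ∫ x, f (x i) * f (x j) ∂P
  have hprod : ∀ i j (x : ℕ → Y), f (x i) * f (x j) ∈ Set.Icc (0 : ℝ) 1 := fun i j x =>
    ⟨mul_nonneg (hf01 _).1 (hf01 _).1, mul_le_one₀ (hf01 _).2 (hf01 _).1 (hf01 _).2⟩
  have hint : ∀ i j, Integrable (fun x : ℕ → Y => f (x i) * f (x j)) P := fun i j =>
    integrable_of_mem_Icc (C := 1) (by fun_prop)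
      fun x => abs_le.2 ⟨by linarith [(hprod i j x).1], (hprod i j x).2⟩
  have hc : ∀ i j, c i j = c 0 1 + if i = j then c 0 0 - c 0 1 else 0 := by
    intro i j
    split_ifs with h
    · subst h
      simpa using hP.integral_sq_eq hf i 0
    · simpa using hP.integral_mul_eq hf h zero_ne_one
  have h1 : c 0 0 ≤ 1 := by
    have := integral_mono (hint 0 0) (integrable_const (1 : ℝ)) fun x => (hprod 0 0 x).2
    simpa using this
  have h0 : 0 ≤ c 0 1 := integral_nonneg fun x => (hprod 0 1 x).1
  have key : ∫ x, (∑ i ∈ range n, w i * f (x i)) ^ 2 ∂P =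
      ∑ i ∈ range n, ∑ j ∈ range n, w i * w j * c i j := by
    have : ∀ x : ℕ → Y, (∑ i ∈ range n, w i * f (x i)) ^ 2 =
        ∑ i ∈ range n, ∑ j ∈ range n, w i * w j * (f (x i) * f (x j)) := fun x => by
      rw [sq, sum_mul_sum]
      exact sum_congr rfl fun i _ => sum_congr rfl fun j _ => by ring
    simp only [this]
    rw [integral_finsetSum _ fun i _ => integrable_finsetSum _ fun j _ => (hint i j).const_mul _]
    refine sum_congr rfl fun i _ => ?_
    rw [integral_finsetSum _ fun j _ => (hint i j).const_mul _]
    exact sum_congr rfl fun j _ => integral_const_mul _ _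
  have hsum : ∑ i ∈ range n, ∑ j ∈ range n, w i * w j * c i j =
      (c 0 0 - c 0 1) * ∑ i ∈ range n, w i ^ 2 := by
    have hterm : ∀ i ∈ range n, ∑ j ∈ range n, w i * w j * c i j =
        w i * (∑ j ∈ range n, w j) * c 0 1 + (c 0 0 - c 0 1) * w i ^ 2 := by
      intro i hi
      calc _ = ∑ j ∈ range n, (w i * w j * c 0 1 +
              if i = j then w i * w j * (c 0 0 - c 0 1) else 0) := by
            refine sum_congr rfl fun j _ => ?_
            rw [hc i j, mul_add, mul_ite, mul_zero]
        _ = _ := by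
            rw [sum_add_distrib, sum_ite_eq, if_pos hi, ← sum_mul, ← mul_sum]
            ring
    rw [sum_congr rfl hterm, hw, mul_sum]
    simp
  rw [key, hsum]
  exact mul_le_of_le_one_left (sum_nonneg fun i _ => sq_nonneg _) (by linarith)

lemma IsSwapInvariant.integral_empMean_sub_sq_le (hP : IsSwapInvariant P) (hf : Measurable f)
    (hf01 : ∀ y, f y ∈ Set.Icc (0 : ℝ) 1) (k : ℕ) :
    ∫ x, (empMean f (4 ^ (k + 1)) x - empMean f (4 ^ k) x) ^ 2 ∂P ≤ 4 * (4 ^ k : ℝ)⁻¹ := by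
  -- the difference of the means is a weighted sum, with weights that sum to zero
  let w : ℕ → ℝ := fun i => (4 ^ (k + 1) : ℝ)⁻¹ - if i < 4 ^ k then (4 ^ k : ℝ)⁻¹ else 0
  have hpos : (0 : ℝ) < 4 ^ k := by positivity
  have hsub : range (4 ^ k) = (range (4 ^ (k + 1))).filter (· < 4 ^ k) := by
    ext i
    simp only [mem_range, mem_filter, pow_succ]
    omega
  have hw : ∀ x : ℕ → Y, ∑ i ∈ range (4 ^ (k + 1)), w i * f (x i) =
      empMean f (4 ^ (k + 1)) x - empMean f (4 ^ k) x := by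
    intro x
    unfold empMean
    rw [hsub, sum_filter, mul_sum, mul_sum, ← sum_sub_distrib]
    refine sum_congr rfl fun i _ => ?_
    simp only [w]
    split_ifs <;> push_cast <;> ring
  have hw0 : ∑ i ∈ range (4 ^ (k + 1)), w i = 0 := by
    simp only [w, sum_sub_distrib, ← sum_filter, ← hsub, sum_const, card_range, nsmul_eq_mul]
    push_cast
    field_simp
    simp
  have hle : ∀ i ∈ range (4 ^ (k + 1)), w i ^ 2 ≤ ((4 ^ k : ℝ)⁻¹) ^ 2 := by
    intro i _
    have h4 : (4 ^ (k + 1) : ℝ)⁻¹ = (4 ^ k : ℝ)⁻¹ / 4 := by rw [pow_succ, mul_inv]; ring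
    have hi : 0 < (4 ^ k : ℝ)⁻¹ := inv_pos.2 hpos
    refine sq_le_sq' ?_ ?_ <;> simp only [w, h4] <;> split_ifs <;> linarith
  simp only [← hw]
  refine (hP.integral_weighted_sq_le hf hf01 hw0).trans ((sum_le_sum hle).trans_eq ?_)
  rw [sum_const, card_range, nsmul_eq_mul]
  push_cast
  field_simp
  ring

lemma IsSwapInvariant.tendsto_empMean (hP : IsSwapInvariant P) (hf : Measurable f)
    (hf01 : ∀ y, f y ∈ Set.Icc (0 : ℝ) 1) :
    ∀ᵐ x ∂P, Tendsto (fun k : ℕ => empMean f (4 ^ k) x) atTop (𝓝 (limMean f x)) := by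
  let D : ℕ → (ℕ → Y) → ℝ := fun k x => empMean f (4 ^ (k + 1)) x - empMean f (4 ^ k) x
  have hDm : ∀ k, Measurable (D k) := fun k =>
    (measurable_empMean hf _).sub (measurable_empMean hf _)
  have hD1 : ∀ k x, |D k x| ≤ 1 := fun k x => by
    have h1 := empMean_mem_Icc hf01 (4 ^ (k + 1)) x
    have h2 := empMean_mem_Icc hf01 (4 ^ k) x
    exact abs_le.2 ⟨by linarith [h1.1, h2.2], by linarith [h1.2, h2.1]⟩
  have hDint : ∀ k, ∫ x, |D k x| ∂P ≤ 5 / 2 * (1 / 2) ^ k := by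
    intro k
    -- integrate `|D| ≤ (2⁻ᵏ + 2ᵏ D²) / 2`, where `D²` has integral at most `4 * 4⁻ᵏ`
    have hp : (0 : ℝ) < 2 ^ k := by positivity
    have h42 : (4 : ℝ) ^ k = 2 ^ k * 2 ^ k := by rw [← mul_pow]; norm_num
    have hi1 : Integrable (fun x => |D k x|) P :=
      integrable_of_mem_Icc (hDm k).abs fun x => by rw [abs_abs]; exact hD1 k x
    have hi2 : Integrable (fun x => D k x ^ 2) P :=
      integrable_of_mem_Icc (C := 1) ((hDm k).pow_const 2) fun x => by
        rw [abs_of_nonneg (sq_nonneg _), ← sq_abs]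
        exact pow_le_one₀ (abs_nonneg _) (hD1 k x)
    have hi3 : Integrable (fun x => ((2 : ℝ) ^ k)⁻¹ / 2 + 2 ^ k / 2 * D k x ^ 2) P :=
      (integrable_const _).add (hi2.const_mul _)
    calc ∫ x, |D k x| ∂P ≤ ∫ x, (((2 : ℝ) ^ k)⁻¹ / 2 + 2 ^ k / 2 * D k x ^ 2) ∂P := by
          refine integral_mono hi1 hi3 fun x => ?_
          have h : ((2 : ℝ) ^ k)⁻¹ / 2 + 2 ^ k / 2 * D k x ^ 2 - |D k x| =
              (2 : ℝ) ^ k / 2 * (|D k x| - ((2 : ℝ) ^ k)⁻¹) ^ 2 := by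
            rw [← sq_abs (D k x)]
            field_simp
            ring
          have : 0 ≤ (2 : ℝ) ^ k / 2 * (|D k x| - ((2 : ℝ) ^ k)⁻¹) ^ 2 := by positivity
          show |D k x| ≤ ((2 : ℝ) ^ k)⁻¹ / 2 + 2 ^ k / 2 * D k x ^ 2
          linarith
      _ = ((2 : ℝ) ^ k)⁻¹ / 2 + 2 ^ k / 2 * ∫ x, D k x ^ 2 ∂P := by
          rw [integral_add (integrable_const _) (hi2.const_mul _), integral_const_mul]
          simp
      _ ≤ ((2 : ℝ) ^ k)⁻¹ / 2 + 2 ^ k / 2 * (4 * (4 ^ k : ℝ)⁻¹) := by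
          gcongr
          exact hP.integral_empMean_sub_sq_le hf hf01 k
      _ = 5 / 2 * (1 / 2) ^ k := by
          rw [h42, one_div, inv_pow]
          field_simp
          ring
  have hfin : ∫⁻ x, ∑' k, ENNReal.ofReal |D k x| ∂P ≠ ∞ := by
    rw [lintegral_tsum fun k => ((hDm k).abs.ennreal_ofReal).aemeasurable]
    have hle : ∀ k, ∫⁻ x, ENNReal.ofReal |D k x| ∂P ≤ ENNReal.ofReal (5 / 2 * (1 / 2) ^ k) := by
      intro k
      rw [← ofReal_integral_eq_lintegral_ofReal]
      · exact ENNReal.ofReal_le_ofReal (hDint k)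
      · exact integrable_of_mem_Icc (hDm k).abs fun x => by rw [abs_abs]; exact hD1 k x
      · exact ae_of_all _ fun x => abs_nonneg _
    refine ne_top_of_le_ne_top ?_ (ENNReal.tsum_le_tsum hle)
    exact (summable_geometric_two.mul_left _).tsum_ofReal_ne_top
  filter_upwards [ae_lt_top (.tsum fun k => (hDm k).abs.ennreal_ofReal) hfin] with x hx
  have hsum : Summable fun k => |D k x| := by
    have := ENNReal.summable_toReal hx.ne
    simpa [ENNReal.toReal_ofReal] using this
  have hcau : CauchySeq fun k : ℕ => empMean f (4 ^ k) x :=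
    cauchySeq_of_summable_dist (by
      simpa only [Real.dist_eq, abs_sub_comm, D, Nat.succ_eq_add_one] using hsum)
  obtain ⟨l, hl⟩ := cauchySeq_tendsto_of_complete hcau
  rwa [limMean, hl.limsup_eq]

lemma IsSwapInvariant.limMean_mem_Icc (hP : IsSwapInvariant P) (hf : Measurable f)
    (hf01 : ∀ y, f y ∈ Set.Icc (0 : ℝ) 1) : ∀ᵐ x ∂P, limMean f x ∈ Set.Icc (0 : ℝ) 1 := by
  filter_upwards [hP.tendsto_empMean hf hf01] with x hx
  exact isClosed_Icc.mem_of_tendsto hx (.of_forall fun k => empMean_mem_Icc hf01 _ x)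

/-- All the integrals of `f (x i) * G x` with `i ≥ N` agree with that for `i = j`, so that their Cesàro
means converge to it; by dominated convergence these also converge to the right-hand side. -/
lemma IsSwapInvariant.integral_mul_limMean (hP : IsSwapInvariant P) (hf : Measurable f)
    (hf01 : ∀ y, f y ∈ Set.Icc (0 : ℝ) 1) {G : (ℕ → Y) → ℝ} (hG : Measurable G) {C : ℝ}
    (hGC : ∀ᵐ x ∂P, |G x| ≤ C) {j N : ℕ}
    (hGN : ∀ i ≥ N, ∀ x, G (fun n => x (Equiv.swap j i n)) = G x) :
    ∫ x, f (x j) * G x ∂P = ∫ x, limMean f x * G x ∂P := by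
  have habs : ∀ {a : ℝ}, a ∈ Set.Icc (0 : ℝ) 1 → |a| ≤ 1 := fun h =>
    abs_le.2 ⟨by linarith [h.1], h.2⟩
  have hbd : ∀ {H : (ℕ → Y) → ℝ}, (∀ x, H x ∈ Set.Icc (0 : ℝ) 1) →
      ∀ᵐ x ∂P, ‖H x * G x‖ ≤ C := fun h => by
    filter_upwards [hGC] with x hx
    rw [Real.norm_eq_abs, abs_mul]
    exact (mul_le_of_le_one_left (abs_nonneg _) (habs (h x))).trans hx
  have h4 : Tendsto (fun k : ℕ => 4 ^ k) atTop atTop := tendsto_pow_atTop_atTop_of_one_lt (by simp)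
  have hswap : ∀ i ≥ N, ∫ x, f (x i) * G x ∂P = ∫ x, f (x j) * G x ∂P := fun i hi => by
    have := hP.integral_comp j i (G := fun x => f (x i) * G x)
      ((hf.comp (measurable_pi_apply i)).mul hG)
    simp only [hGN i hi, Equiv.swap_apply_right] at this
    exact this.symm
  have hint : ∀ i, Integrable (fun x => f (x i) * G x) P := fun i =>
    Integrable.of_bound ((hf.comp (measurable_pi_apply i)).mul hG).aestronglyMeasurable C
      (hbd fun x => hf01 _)
  have hmean : ∀ n, ∫ x, empMean f n x * G x ∂P =
      (n : ℝ)⁻¹ * ∑ i ∈ range n, ∫ x, f (x i) * G x ∂P := fun n => by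
    rw [← integral_finsetSum _ fun i _ => hint i, ← integral_const_mul]
    refine integral_congr_ae (ae_of_all _ fun x => ?_)
    simp only [empMean, ← sum_mul, mul_assoc]
  have hlim : Tendsto (fun n => ∫ x, empMean f n x * G x ∂P) atTop (𝓝 (∫ x, f (x j) * G x ∂P)) := by
    simp only [hmean]
    refine Tendsto.cesaro (tendsto_const_nhds.congr' ?_)
    filter_upwards [eventually_ge_atTop N] with i hi
    exact (hswap i hi).symm
  refine tendsto_nhds_unique (hlim.comp h4) ?_
  refine tendsto_integral_of_dominated_convergence (fun _ => C)
    (fun k => ((measurable_empMean hf _).mul hG).aestronglyMeasurable) (integrable_const _)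
    (fun k => hbd fun x => empMean_mem_Icc hf01 _ x) ?_
  filter_upwards [hP.tendsto_empMean hf hf01] with x hx
  exact hx.mul_const _

end

/-- The coordinates are replaced by limiting means one at a time; `u` collects the indices already
replaced. -/
lemma IsSwapInvariant.integral_prod_eq {Y : Type u} [MeasurableSpace Y] {P : Measure (ℕ → Y)}
    [IsProbabilityMeasure P] (hP : IsSwapInvariant P) {f : ℕ → Y → ℝ} (hf : ∀ n, Measurable (f n))
    (hf01 : ∀ n y, f n y ∈ Set.Icc (0 : ℝ) 1) (s : Finset ℕ) :
    ∫ x, ∏ n ∈ s, f n (x n) ∂P = ∫ x, ∏ n ∈ s, limMean (f n) x ∂P := by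
  suffices h : ∀ u, Disjoint s u → ∫ x, (∏ n ∈ s, f n (x n)) * ∏ n ∈ u, limMean (f n) x ∂P =
      ∫ x, ∏ n ∈ s ∪ u, limMean (f n) x ∂P by
    simpa using h ∅ (disjoint_empty_right s)
  induction s using Finset.induction_on with
  | empty => simp
  | insert a s ha ih =>
    intro u hu
    rw [disjoint_insert_left] at hu
    have hlim : ∀ᵐ x ∂P, ∀ n, limMean (f n) x ∈ Set.Icc (0 : ℝ) 1 :=
      ae_all_iff.2 fun n => hP.limMean_mem_Icc (hf n) (hf01 n)
    have hstep := hP.integral_mul_limMean (hf a) (hf01 a) (j := a) (N := s.sup id + 1) (C := 1)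
      (G := fun x => (∏ n ∈ s, f n (x n)) * ∏ n ∈ u, limMean (f n) x)
      ((Finset.measurable_fun_prod s fun n _ => (hf n).comp (measurable_pi_apply n)).mul
        (Finset.measurable_fun_prod u fun n _ => measurable_limMean (hf n)))
      (by
        filter_upwards [hlim] with x hx
        have h1 : 0 ≤ ∏ n ∈ s, f n (x n) := prod_nonneg fun n _ => (hf01 n _).1
        have h2 : ∏ n ∈ s, f n (x n) ≤ 1 :=
          prod_le_one (fun n _ => (hf01 n _).1) fun n _ => (hf01 n _).2
        have h3 : 0 ≤ ∏ n ∈ u, limMean (f n) x := prod_nonneg fun n _ => (hx n).1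
        have h4 : ∏ n ∈ u, limMean (f n) x ≤ 1 :=
          prod_le_one (fun n _ => (hx n).1) fun n _ => (hx n).2
        rw [abs_of_nonneg (mul_nonneg h1 h3)]
        exact mul_le_one₀ h2 h3 h4)
      (fun i hi x => by
        simp only [limMean_swap]
        congr 1
        refine prod_congr rfl fun n hn => ?_
        have h1 : n ≤ s.sup id := le_sup (f := id) hn
        rw [Equiv.swap_apply_of_ne_of_ne (ne_of_mem_of_not_mem hn ha) (by omega)])
    calc _ = ∫ x, f a (x a) * ((∏ n ∈ s, f n (x n)) * ∏ n ∈ u, limMean (f n) x) ∂P := by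
          simp only [prod_insert ha, mul_assoc]
      _ = _ := hstep
      _ = ∫ x, (∏ n ∈ s, f n (x n)) * ∏ n ∈ insert a u, limMean (f n) x ∂P := by
          simp only [prod_insert hu.1]
          exact integral_congr_ae (ae_of_all _ fun x => by ring)
      _ = _ := ih (insert a u) (disjoint_insert_right.2 ⟨ha, hu.2⟩)
      _ = _ := by rw [union_insert, insert_union]

/-! ### The limiting empirical distribution -/

/-- The exchangeable `σ`-algebra: measurable sets that are invariant under transpositions. -/
@[reducible] def exchSigma (Y : Type u) [MeasurableSpace Y] : MeasurableSpace (ℕ → Y) where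
  MeasurableSet' A := MeasurableSet A ∧
    ∀ (i j : ℕ) (x : ℕ → Y), (fun n => x (Equiv.swap i j n)) ∈ A ↔ x ∈ A
  measurableSet_empty := ⟨.empty, fun _ _ _ => Iff.rfl⟩
  measurableSet_compl _ hA := ⟨hA.1.compl, fun i j x => not_congr (hA.2 i j x)⟩
  measurableSet_iUnion _ hA := ⟨.iUnion fun n => (hA n).1, fun i j x => by
    simp only [Set.mem_iUnion, (hA _).2 i j x]⟩

lemma exchSigma_le (Y : Type u) [MeasurableSpace Y] : exchSigma Y ≤ MeasurableSpace.pi :=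
  fun _ hA => hA.1

lemma measurable_exchSigma_limMean {Y : Type u} [MeasurableSpace Y] {f : Y → ℝ}
    (hf : Measurable f) : Measurable[exchSigma Y] (limMean f) := fun B hB =>
  ⟨measurable_limMean hf hB, fun i j x => by simp only [Set.mem_preimage, limMean_swap]⟩

lemma IsSwapInvariant.limMean_ae_eq_condExp {Y : Type u} [MeasurableSpace Y] {P : Measure (ℕ → Y)}
    [IsProbabilityMeasure P] (hP : IsSwapInvariant P) {f : Y → ℝ} (hf : Measurable f)
    (hf01 : ∀ y, f y ∈ Set.Icc (0 : ℝ) 1) :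
    limMean f =ᵐ[P] P[fun x => f (x 0) | exchSigma Y] := by
  have hint : Integrable (fun x : ℕ → Y => f (x 0)) P :=
    integrable_of_mem_Icc (C := 1) (hf.comp (measurable_pi_apply 0)) fun x =>
      abs_le.2 ⟨by linarith [(hf01 (x 0)).1], (hf01 (x 0)).2⟩
  have hlim : Integrable (limMean f) P := by
    refine Integrable.of_bound (measurable_limMean hf).aestronglyMeasurable 1 ?_
    filter_upwards [hP.limMean_mem_Icc hf hf01] with x hx
    exact abs_le.2 ⟨by linarith [hx.1], hx.2⟩
  refine ae_eq_condExp_of_forall_setIntegral_eq (exchSigma_le Y) hint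
    (fun s _ _ => hlim.integrableOn) (fun s hs _ => ?_)
    (measurable_exchSigma_limMean hf).stronglyMeasurable.aestronglyMeasurable
  have h := hP.integral_mul_limMean hf hf01 (G := s.indicator 1) (C := 1) (j := 0) (N := 0)
    (measurable_one.indicator hs.1)
    (ae_of_all _ fun x => by by_cases hx : x ∈ s <;> simp [hx])
    (fun i _ x => by
      by_cases hx : x ∈ s
      · simp [hx, (hs.2 0 i x).2 hx]
      · simp [hx, mt (hs.2 0 i x).1 hx])
  rw [← integral_indicator hs.1, ← integral_indicator hs.1]
  have hind : ∀ g : (ℕ → Y) → ℝ, (fun x => g x * s.indicator 1 x) = s.indicator g := fun g => by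
    ext x
    by_cases hx : x ∈ s <;> simp [hx]
  rw [← hind (limMean f), ← hind fun x => f (x 0)]
  exact h.symm

/-- The limiting frequency with which a sequence visits a set. -/
noncomputable def limFreq {Y : Type u} (A : Set Y) : (ℕ → Y) → ℝ := limMean (A.indicator 1)

lemma indicator_mem_Icc {Y : Type u} (A : Set Y) (y : Y) :
    A.indicator (1 : Y → ℝ) y ∈ Set.Icc (0 : ℝ) 1 := by
  by_cases h : y ∈ A <;> simp [h]

lemma measurable_limFreq_Iic :
    Measurable fun (x : ℕ → ℝ) (q : ℚ) => limFreq (Set.Iic (q : ℝ)) x :=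
  measurable_pi_lambda _ fun _ => measurable_limMean (measurable_one.indicator measurableSet_Iic)

/-- The limiting empirical distribution of a real sequence. It is the probability measure whose
distribution function is given at rational points by the limiting frequencies; where these are not the
values of a distribution function, it is the default value of `stieltjesOfMeasurableRat`. -/
noncomputable def empLaw (x : ℕ → ℝ) : Measure ℝ :=
  (stieltjesOfMeasurableRat (fun (x : ℕ → ℝ) (q : ℚ) => limFreq (Set.Iic (q : ℝ)) x)
    measurable_limFreq_Iic x).measure

instance (x : ℕ → ℝ) : IsProbabilityMeasure (empLaw x) :=
  instIsProbabilityMeasure_stieltjesOfMeasurableRat _ x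

lemma measurable_empLaw : Measurable empLaw :=
  measurable_measure_stieltjesOfMeasurableRat measurable_limFreq_Iic

lemma isRatStieltjesPoint_of_measure {α : Type u} {f : α → ℚ → ℝ} {a : α} (μ : Measure ℝ)
    [IsProbabilityMeasure μ] (h : ∀ q : ℚ, f a q = μ.real (Set.Iic (q : ℝ))) :
    IsRatStieltjesPoint f a := by
  have hf : f a = fun q : ℚ => cdf μ q := funext fun q => by rw [h, cdf_eq_real]
  refine ⟨?_, ?_, ?_, fun t => ?_⟩
  · rw [hf]
    exact fun p q hpq => monotone_cdf μ (Rat.cast_le.2 hpq)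
  · rw [hf]
    exact (tendsto_cdf_atTop μ).comp (tendsto_ratCast_atTop_iff.2 tendsto_id)
  · rw [hf]
    exact (tendsto_cdf_atBot μ).comp (tendsto_ratCast_atBot_iff.2 tendsto_id)
  · rw [hf]
    refine Eq.trans ?_ ((cdf μ).iInf_rat_gt_eq t)
    exact Equiv.iInf_congr (Equiv.subtypeEquivRight fun r => by simp) fun _ => rfl

lemma empLaw_eq_of_limFreq {x : ℕ → ℝ} (μ : Measure ℝ) [IsProbabilityMeasure μ]
    (h : ∀ q : ℚ, limFreq (Set.Iic (q : ℝ)) x = μ.real (Set.Iic (q : ℝ))) : empLaw x = μ := by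
  have hx := isRatStieltjesPoint_of_measure
    (f := fun (x : ℕ → ℝ) (q : ℚ) => limFreq (Set.Iic (q : ℝ)) x) μ h
  refine ext_of_generate_finite _ Real.borel_eq_generateFrom_Iic_rat Real.isPiSystem_Iic_rat ?_
    (by simp)
  intro A hA
  obtain ⟨q, rfl⟩ : ∃ q : ℚ, A = Set.Iic (q : ℝ) := by simpa [eq_comm] using hA
  rw [empLaw, measure_stieltjesOfMeasurableRat_Iic, stieltjesOfMeasurableRat_eq,
    toRatCDF_of_isRatStieltjesPoint hx, h, ofReal_measureReal]

/-- The conditional distribution `m` of the first coordinate given the exchangeable `σ`-algebra has the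
limiting frequencies as its values, for each measurable set almost surely. Hence `empLaw` is almost
surely equal to `m`. -/
lemma IsSwapInvariant.empLaw_real {P : Measure (ℕ → ℝ)} [IsProbabilityMeasure P]
    (hP : IsSwapInvariant P) {A : Set ℝ} (hA : MeasurableSet A) :
    ∀ᵐ x ∂P, (empLaw x).real A = limFreq A x := by
  let m : (ℕ → ℝ) → Measure ℝ := fun x => (condExpKernel P (exchSigma ℝ) x).map fun y => y 0
  have hm : ∀ x, IsProbabilityMeasure (m x) := fun x =>
    Measure.isProbabilityMeasure_map (measurable_pi_apply 0).aemeasurable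
  have key : ∀ {B : Set ℝ}, MeasurableSet B → ∀ᵐ x ∂P, limFreq B x = (m x).real B := by
    intro B hB
    have hB' : MeasurableSet ((fun y : ℕ → ℝ => y 0) ⁻¹' B) := measurable_pi_apply 0 hB
    filter_upwards [hP.limMean_ae_eq_condExp (measurable_one.indicator hB) (indicator_mem_Icc B),
      condExpKernel_ae_eq_condExp (μ := P) (exchSigma_le ℝ) hB'] with x h1 h2
    rw [limFreq, h1, map_measureReal_apply (measurable_pi_apply 0) hB, h2]
    rfl
  have hQ : ∀ᵐ x ∂P, ∀ q : ℚ, limFreq (Set.Iic (q : ℝ)) x = (m x).real (Set.Iic (q : ℝ)) :=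
    ae_all_iff.2 fun q => key measurableSet_Iic
  filter_upwards [hQ, key hA] with x h1 h2
  rw [empLaw_eq_of_limFreq (m x) h1, h2]

/-- **De Finetti's theorem** for real sequences, on cylinder sets. -/
theorem IsSwapInvariant.measure_pi {P : Measure (ℕ → ℝ)} [IsProbabilityMeasure P]
    (hP : IsSwapInvariant P) (s : Finset ℕ) {t : ℕ → Set ℝ} (ht : ∀ n, MeasurableSet (t n)) :
    P (Set.pi s t) = ∫⁻ x, ∏ n ∈ s, empLaw x (t n) ∂P := by
  have hreal : P.real (Set.pi s t) = ∫ x, ∏ n ∈ s, (empLaw x).real (t n) ∂P := by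
    have h1 := hP.integral_prod_eq (fun n => measurable_one.indicator (ht n))
      (fun n => indicator_mem_Icc (t n)) s
    have h2 : ∀ x : ℕ → ℝ, ∏ n ∈ s, (t n).indicator (1 : ℝ → ℝ) (x n) =
        (Set.pi (s : Set ℕ) t).indicator 1 x := fun x => by
      by_cases hx : x ∈ Set.pi (s : Set ℕ) t
      · rw [Set.indicator_of_mem hx]
        exact prod_eq_one fun n hn => Set.indicator_of_mem (hx n hn) _
      · rw [Set.indicator_of_notMem hx]
        obtain ⟨n, hn, hxn⟩ : ∃ n ∈ s, x n ∉ t n := by simpa [Set.mem_pi] using hx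
        exact prod_eq_zero hn (Set.indicator_of_notMem hxn _)
    simp only [h2] at h1
    rw [integral_indicator_one (.pi s.countable_toSet fun n _ => ht n)] at h1
    rw [h1]
    refine integral_congr_ae ?_
    filter_upwards [ae_all_iff.2 fun n => hP.empLaw_real (ht n)] with x hx
    exact prod_congr rfl fun n _ => (hx n).symm
  rw [← ofReal_measureReal, hreal, ofReal_integral_eq_lintegral_ofReal]
  · refine lintegral_congr fun x => ?_
    rw [ENNReal.ofReal_prod_of_nonneg fun n _ => measureReal_nonneg]
    simp
  · refine Integrable.of_bound (Measurable.aestronglyMeasurable ?_) 1 (ae_of_all _ fun x => ?_)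
    · exact Finset.measurable_fun_prod s fun n _ =>
        ((Measure.measurable_coe (ht n)).comp measurable_empLaw).ennreal_toReal
    · rw [Real.norm_eq_abs, abs_of_nonneg (prod_nonneg fun n _ => measureReal_nonneg)]
      exact prod_le_one (fun n _ => measureReal_nonneg) fun n _ => measureReal_le_one
  · exact ae_of_all _ fun x => prod_nonneg fun n _ => measureReal_nonneg

/-! ### De Finetti's theorem in quasi-universal spaces -/

lemma isUniversal_real : IsUniversal ℝ := by
  refine ⟨⟨Set.univ, @MeasurableSet.univ ℝ omegaSigma, ⟨?_⟩⟩, ?_⟩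
  · rw [univCompletion_sigma, sigma_real]
    exact @MeasurableEquiv.mk ℝ _ omegaSigma (omegaSigma.comap Subtype.val) (Equiv.Set.univ ℝ).symm
      (fun _ ⟨B, hB, h⟩ => by rw [← h]; exact hB)
      (@comap_measurable _ _ omegaSigma Subtype.val)
  · rw [sigma_real]
    rfl

lemma sigma_real_le : sigma ℝ ≤ univCompletion (borel ℝ) := sigma_real.le

lemma pi_borel_le_sigma : (MeasurableSpace.pi : MeasurableSpace (ℕ → ℝ)) ≤ sigma (ℕ → ℝ) := by
  refine le_trans (iSup_mono fun n => MeasurableSpace.comap_mono ?_) (piSigma_le ℝ)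
  rw [sigma_real]
  exact borel_le_omegaSigma

lemma sigma_le_univCompletion_pi :
    sigma (ℕ → ℝ) ≤ univCompletion (MeasurableSpace.pi : MeasurableSpace (ℕ → ℝ)) :=
  sigma_le_of_retract (i := seqEquiv) seqEquiv.measurable seqEquiv_symm_mem
    seqEquiv.symm_apply_apply

noncomputable section

/-- The limiting empirical distribution, extended to the universally measurable sets. -/
def empLawG (y : ℕ → ℝ) : ProbG ℝ :=
  ⟨extend (sigma ℝ) (empLaw y) fun _ hA => sigma_real_le _ hA _ inferInstance,
    extend_prob _ inferInstance⟩

lemma empLawG_val (y : ℕ → ℝ) {A : Set ℝ} (hA : MeasurableSet[sigma ℝ] A) :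
    (empLawG y).val A = empLaw y A :=
  extend_apply (fun _ hA => sigma_real_le _ hA _ inferInstance) hA

/-- The limiting empirical distribution as a Markov kernel. -/
def empKernel : MarkovKernel (ℕ → ℝ) ℝ :=
  MarkovKernel.mk empLawG fun γ hγ => by
    have hγm : @Measurable ℝ (ℕ → ℝ) omegaSigma MeasurableSpace.pi γ :=
      fun A hA => pi_borel_le_sigma _ hA γ hγ
    obtain ⟨κ, hκ, hκγ⟩ := exists_plot_ProbQ (κ := fun ω => empLawG (γ ω)) <| by
      intro A hA
      have hle : borel ℝ ≤ sigma ℝ := by rw [sigma_real]; exact borel_le_omegaSigma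
      refine measurable_of_completion (univCompletion_idem _) hle
        (fun ω => (empLawG (γ ω)).1) (fun ω => (empLawG (γ ω)).2) (fun B hB => ?_) hA
      have h : ∀ ω, (empLawG (γ ω)).1 B = empLaw (γ ω) B := fun ω => empLawG_val _ (hle _ hB)
      simp only [h]
      exact @Measurable.comp ℝ _ _ omegaSigma _ _ _ _
        ((Measure.measurable_coe hB).comp measurable_empLaw) hγm
    refine ⟨id, @measurable_id ℝ omegaSigma, κ, hκ, fun ω => ProbG.ext fun A hA => ?_⟩
    rw [ProbG.map_val _ _ hA, hκγ]
    rfl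

/-- The push-forward of a Markov kernel along a quasi-measurable map. -/
def MarkovKernel.map {Z : Type w} {X : Type u} {Y : Type v} [QUSpace Z] [QUSpace X] [QUSpace Y]
    (K : MarkovKernel Z X) (f : X → Y) (hf : IsQM f) : MarkovKernel Z Y :=
  MarkovKernel.mk (fun z => (K.law z).map f hf) fun γ hγ => by
    obtain ⟨α, hα, κ, hκ, h⟩ := K.2 γ hγ
    refine ⟨f ∘ α, hf α hα, κ, hκ, fun ω => ?_⟩
    have hω : K.law (γ ω) = (κ ω).1.map α (plot_isQM hα) := h ω
    rw [hω, ProbG.map_map]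

/-- Exchangeability, in terms of transpositions, of a measure on the `σ`-algebra of the quasi-universal
space `X^ℕ`. -/
def IsSwapInvariantG {X : Type u} [QUSpace X] (μ : ProbG (ℕ → X)) : Prop :=
  ∀ i j, μ.map (fun x n => x (Equiv.swap i j n)) (isQM_reindex (Equiv.swap i j)) = μ

lemma IsSwapInvariantG.trim {ν : ProbG (ℕ → ℝ)} (hν : IsSwapInvariantG ν) :
    IsSwapInvariant (ν.1.trim pi_borel_le_sigma) := by
  intro i j
  have hm : Measurable fun (x : ℕ → ℝ) n => x (Equiv.swap i j n) := by fun_prop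
  refine ⟨hm, Measure.ext fun A hA => ?_⟩
  rw [Measure.map_apply hm hA, trim_measurableSet_eq _ (hm hA), trim_measurableSet_eq _ hA]
  have h := congrArg (fun ρ : ProbG (ℕ → ℝ) => ρ.val A) (hν i j)
  rwa [ProbG.map_val _ _ (pi_borel_le_sigma _ hA)] at h

lemma IsSwapInvariantG.map_pow {X : Type u} {Y : Type v} [QUSpace X] [QUSpace Y]
    {μ : ProbG (ℕ → X)} (hμ : IsSwapInvariantG μ) {f : X → Y} (hf : IsQM f) :
    IsSwapInvariantG (μ.map (fun x n => f (x n)) (isQM_pow fun _ => hf)) := fun i j => by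
  conv_rhs => rw [← hμ i j]
  rw [ProbG.map_map, ProbG.map_map]
  rfl

/-- **De Finetti's theorem** for exchangeable laws on the quasi-universal space `ℝ^ℕ`. The two sides agree
on cylinders, hence on Borel sets, hence on universally measurable sets. -/
lemma IsSwapInvariantG.eq_bind_real {ν : ProbG (ℕ → ℝ)} (hν : IsSwapInvariantG ν) :
    ν = (MarkovKernel.prod isUniversal_real fun _ => empKernel).bind ν := by
  set K := MarkovKernel.prod isUniversal_real fun _ => empKernel
  have hνp : IsProbabilityMeasure (ν.1.trim pi_borel_le_sigma) :=
    @prob_trim _ _ _ pi_borel_le_sigma ν.1 ν.2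
  have hle : borel ℝ ≤ sigma ℝ := by rw [sigma_real]; exact borel_le_omegaSigma
  have htrim : ν.1.trim pi_borel_le_sigma = (K.bind ν).1.trim pi_borel_le_sigma := by
    refine ext_of_generate_finite _ generateFrom_squareCylinders.symm
      (isPiSystem_squareCylinders (fun _ => MeasurableSpace.isPiSystem_measurableSet)
        fun _ => (MeasurableSet.univ : MeasurableSet (Set.univ : Set ℝ))) ?_ ?_
    · rintro _ ⟨s, t, ht, rfl⟩
      have ht' : ∀ n, MeasurableSet (t n) := fun n => ht n (Set.mem_univ n)
      have hA : MeasurableSet (Set.pi (s : Set ℕ) t) := .pi s.countable_toSet fun n _ => ht' n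
      rw [hν.trim.measure_pi s ht', trim_measurableSet_eq _ hA]
      refine Eq.trans ?_ (K.bind_val ν (pi_borel_le_sigma _ hA)).symm
      refine (lintegral_trim pi_borel_le_sigma (Finset.measurable_fun_prod s fun n _ =>
        (Measure.measurable_coe (ht' n)).comp measurable_empLaw)).trans ?_
      refine lintegral_congr fun y => ?_
      refine Eq.trans ?_ (prodG_pi isUniversal_real.sigma_pow_le (fun _ => empKernel.law y) s t
        fun n => hle _ (ht' n)).symm
      exact prod_congr rfl fun n _ => (empLawG_val y (hle _ (ht' n))).symm
    · rw [hνp.measure_univ, (@prob_trim _ _ _ pi_borel_le_sigma (K.bind ν).1 (K.bind ν).2).measure_univ]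
  refine Subtype.ext (@eq_of_eq_on _ _ _ pi_borel_le_sigma sigma_le_univCompletion_pi
    ν.1 (K.bind ν).1 ν.2 fun A hA => ?_)
  rw [← trim_measurableSet_eq pi_borel_le_sigma hA, htrim, trim_measurableSet_eq _ hA]

lemma isQM_of_measurable {X : Type u} [QUSpace X] {i : X → ℝ} (hi : Measurable[sigma X, borel ℝ] i) :
    IsQM i := fun α hα => by
  have h := measurable_univCompletion
    (@Measurable.comp _ _ _ omegaSigma (sigma X) (borel ℝ) _ _ hi (plot_measurable hα))
  rwa [univCompletion_idem] at h

/-- **De Finetti's theorem** on a universal space `X`: the law of the sequence `i (x n)` of reals is a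
mixture of product measures, and so is its image under the retraction `r`. -/
lemma IsSwapInvariantG.eq_bind {X : Type u} [QUSpace X] (hX : IsUniversal X) {μ : ProbG (ℕ → X)}
    (hμ : IsSwapInvariantG μ) {i : X → ℝ} {r : ℝ → X} (hi : IsQM i) (hr : IsQM r)
    (hri : ∀ x, r (i x) = x) :
    μ = (MarkovKernel.prod hX fun _ => empKernel.map r hr).bind
      (μ.map (fun x n => i (x n)) (isQM_pow fun _ => hi)) := by
  refine ProbG.ext fun A hA => ?_
  have hR : IsQM fun (y : ℕ → ℝ) n => r (y n) := isQM_pow fun _ => hr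
  have hRA := hR.measurable hA
  rw [MarkovKernel.bind_val _ _ hA]
  have hlaw : ∀ y, ((MarkovKernel.prod hX fun _ => empKernel.map r hr).law y).val A =
      ((MarkovKernel.prod isUniversal_real fun _ => empKernel).law y).val
        ((fun (y : ℕ → ℝ) n => r (y n)) ⁻¹' A) := fun y => by
    rw [← ProbG.map_val hR _ hA]
    exact congrArg (fun ρ : ProbG (ℕ → X) => ρ.val A)
      (prodG_map isUniversal_real.sigma_pow_le hX.sigma_pow_le (fun _ => hr)
        fun _ => empKernel.law y).symm
  simp only [hlaw]
  rw [← MarkovKernel.bind_val _ _ hRA, ← (hμ.map_pow hi).eq_bind_real, ProbG.map_val _ _ hRA]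
  congr 1
  ext x
  simp [hri]

/-! ### Exchangeable Markov kernels -/

lemma prodG_map_reindex {X : Type u} [QUSpace X] (h : sigma (ℕ → X) ≤ univCompletion (piSigma X))
    (μ : ProbG X) (σ : Equiv.Perm ℕ) :
    (prodG h fun _ => μ).map (fun x n => x (σ n)) (isQM_reindex σ) = prodG h fun _ => μ := by
  refine eq_prodG h _ _ fun s t ht => ?_
  have hm : MeasurableSet[sigma (ℕ → X)] (Set.pi (s : Set ℕ) t) := by
    let _ := sigma X
    exact piSigma_le X _ (MeasurableSet.pi s.countable_toSet fun n _ => ht n)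
  rw [ProbG.map_val _ _ hm]
  have hpre : (fun (x : ℕ → X) n => x (σ n)) ⁻¹' Set.pi (s : Set ℕ) t =
      Set.pi (s.map σ.toEmbedding : Finset ℕ) fun n => t (σ.symm n) := by
    ext x
    simp only [Set.mem_preimage, Set.mem_pi, mem_coe, mem_map_equiv]
    exact ⟨fun h n hn => by simpa using h _ hn, fun h n hn => by simpa using h (σ n) (by simpa)⟩
  rw [hpre, prodG_pi h _ _ _ fun n => ht _, prod_map]
  simp

lemma isExchangeable_prod_comp {X : Type u} {Z : Type v} {S : Type w} [QUSpace X] [QUSpace Z]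
    [QUSpace S] (hX : IsUniversal X) (K : MarkovKernel S X) (P : MarkovKernel Z S) :
    IsExchangeable ((MarkovKernel.prod hX fun _ => K).comp P) := by
  intro σ _ z
  refine ProbG.ext fun A hA => ?_
  rw [ProbG.map_val _ _ hA]
  have h1 := (MarkovKernel.prod hX fun _ => K).bind_val (P.law z)
    ((isQM_reindex (X := X) σ).measurable hA)
  have h2 := (MarkovKernel.prod hX fun _ => K).bind_val (P.law z) hA
  refine h1.trans (Eq.trans ?_ h2.symm)
  refine lintegral_congr fun s => ?_
  rw [← ProbG.map_val (isQM_reindex σ) _ hA]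
  exact congrArg (fun ρ : ProbG (ℕ → X) => ρ.val A)
    (prodG_map_reindex hX.sigma_pow_le (K.law s) σ)

lemma IsExchangeable.isSwapInvariantG {X : Type u} {Z : Type v} [QUSpace X] [QUSpace Z]
    {Q : MarkovKernel Z (ℕ → X)} (hQ : IsExchangeable Q) (z : Z) : IsSwapInvariantG (Q.law z) :=
  fun i j => hQ (Equiv.swap i j) ((Set.toFinite {i, j}).subset fun n hn => by
    by_contra h
    simp only [Set.mem_insert_iff, Set.mem_singleton_iff, not_or] at h
    exact hn (Equiv.swap_apply_of_ne_of_ne h.1 h.2)) z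

lemma MarkovKernel.ext {X : Type u} {Z : Type v} [QUSpace X] [QUSpace Z]
    {K L : MarkovKernel Z X} (h : ∀ z, K.law z = L.law z) : K = L :=
  Subtype.ext (funext fun z => Subtype.ext (h z))

/-- The mixing kernel is the push-forward of `Q` along `x ↦ r_* (empLaw (i ∘ x))`, where `X` is a retract
of `ℝ` via `i` and `r`. -/
theorem IsExchangeable.exists_eq_comp {X : Type u} {Z : Type v} [QUSpace X] [QUSpace Z]
    (hX : IsUniversal X) {Q : MarkovKernel Z (ℕ → X)} (hQ : IsExchangeable Q) :
    ∃ P : MarkovKernel Z (Prob X), Q = (MarkovKernel.prod hX fun _ => MarkovKernel.eval X).comp P := by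
  rcases isEmpty_or_nonempty X with hE | ⟨⟨x₀⟩⟩
  -- there is no probability measure on the empty space, hence no `z`
  · have : IsEmpty Z := ⟨fun z => by
      have h := (Q.law z).2.measure_univ
      rw [Set.univ_eq_empty_iff.2 inferInstance, measure_empty] at h
      exact zero_ne_one h⟩
    exact ⟨⟨isEmptyElim, fun α _ => isEmptyElim (α 0)⟩, MarkovKernel.ext isEmptyElim⟩
  obtain ⟨i, r, him, hr, hri⟩ := hX.exists_retract x₀
  have hi : IsQM i := isQM_of_measurable him
  have hr' : IsQM r := plot_isQM hr
  let K := empKernel.map r hr'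
  have hI : IsQM fun (x : ℕ → X) n => i (x n) := isQM_pow fun _ => hi
  have hK : IsQM K.1 := K.2
  refine ⟨Q.map (K.1 ∘ fun x n => i (x n)) (hK.comp hI), MarkovKernel.ext fun z => ?_⟩
  refine ((hQ.isSwapInvariantG z).eq_bind hX hi hr' hri).trans (ProbG.ext fun A hA => ?_)
  rw [MarkovKernel.bind_val _ _ hA]
  refine Eq.trans ?_ ((MarkovKernel.prod hX fun _ => MarkovKernel.eval X).bind_val _ hA).symm
  have hmap : (Q.map (K.1 ∘ fun x n => i (x n)) (hK.comp hI)).law z =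
      ((Q.law z).map _ hI).map K.1 hK := (ProbG.map_map hI hK _).symm
  rw [hmap]
  exact (@lintegral_map _ _ (sigma (ℕ → ℝ)) (sigma (Prob X)) ((Q.law z).map _ hI).1 _ _
    ((MarkovKernel.prod hX fun _ => MarkovKernel.eval X).measurable hA) hK.measurable).symm

end

end QUS

theorem mainTheorem11 {X Z : Type u} [QUS.QUSpace X] [QUS.QUSpace Z] (hX : QUS.IsUniversal X)
    (Q : QUS.MarkovKernel Z (ℕ → X)) :
    (QUS.IsExchangeable Q ↔
      ∃ (S : Type u) (_ : QUS.QUSpace S) (K : QUS.MarkovKernel S X) (P : QUS.MarkovKernel Z S),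
        Q = (QUS.MarkovKernel.prod hX fun _ => K).comp P) ∧
    (QUS.IsExchangeable Q →
      ∃ P : QUS.MarkovKernel Z (QUS.Prob X),
        Q = (QUS.MarkovKernel.prod hX fun _ => QUS.MarkovKernel.eval X).comp P) := by
  refine ⟨⟨fun hQ => ?_, ?_⟩, fun hQ => hQ.exists_eq_comp hX⟩
  · obtain ⟨P, hP⟩ := hQ.exists_eq_comp hX
    exact ⟨QUS.Prob X, inferInstance, QUS.MarkovKernel.eval X, P, hP⟩
  · rintro ⟨S, _, K, P, rfl⟩
    exact QUS.isExchangeable_prod_comp hX K P
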